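/- Let $K$ be a field complete with respect to a non-trivial non-archimedean absolute value $|\cdot|$, such that $K$ and its residue field have characteristic zero. Let $X$ be a projective K3 surface over $K$ (a smooth, projective, geometrically integral surface with trivial canonical bundle and $H^1(X,\mathcal O_X)=0$) and let $f\colon X\to X$ be an automorphism over $K$. Let $\mathbb T=\mathbb G_m^n$ be a split torus, $\pi\colon E\to X$ a (Zariski locally trivial) $\mathbb T$-torsor over $X$, and $F\colon E\to E$ a morphism with $\pi\circ F=f\circ\pi$ and $F(t\cdot e)=F_{\mathbb T}(t)\cdot F(e)$ for all $t\in\mathbb T$, $e\in E$, where $F_{\mathbb T}\colon\mathbb T\to\mathbb T$ is a homomorphism of tori. Let $M_F\colon M(\mathbb T)\to M(\mathbb T)$, $\alpha\mapsto\alpha\circ F_{\mathbb T}$, be the induced map on the character lattice, and suppose that $M_F$ acting on $M(\mathbb T)_{\mathbb R}=M(\mathbb T)\otimes_{\mathbb Z}\mathbb R$ has an eigenvector $v_F\neq 0$ with real eigenvalue $\lambda_F>1$. Let $X^{an}$, $E^{an}$ denote the Berkovich analytifications, and $\mathcal H(x)$ the completed residue field of a point $x\in X^{an}$. For $\alpha=\sum_i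 c_i\alpha_i\in M(\mathbb T)_{\mathbb R}$ with $c_i\in\mathbb R$ and $\alpha_i\in M(\mathbb T)$, a function $G\colon E^{an}\to\mathbb R$ is called $\alpha$-homogeneous if for every $x\in X^{an}$, every point $e$ of the fibre $E^{an}_x$ and every $t\in\mathbb T(\mathcal H(x))$, $$G(t\cdot e)=G(e)+\log|\alpha(t)|,\qquad \log|\alpha(t)|:=\sum_i c_i\log|\alpha_i(t)|.$$ Then there exists a unique continuous function $G\colon E^{an}\to\mathbb R$ which is $v_F$-homogeneous and satisfies $F^*G=\lambda_F\cdot G$, i.e. $G(F^{an}(e))=\lambda_F\,G(e)$ for all $e\in E^{an}$. -/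

import Mathlib

open CategoryTheory AlgebraicGeometry

universe u

noncomputable section

namespace BerkK3

/-! ### Projective K3 surfaces -/

section KthreeSurfaces

variable {K : Type u} [Field K] {X : Scheme.{u}}

/-- The map `K → Γ(X, U)` given by the structure morphism `p : X ⟶ Spec K`. -/
def baseToSections (p : X ⟶ Spec (CommRingCat.of K)) (U : X.Opens) : K →+* Γ(X, U) :=
  ((Scheme.ΓSpecIso (CommRingCat.of K)).inv ≫ p.appLE ⊤ U (by rw [Scheme.Hom.preimage_top]; exact le_top)).hom

theorem baseToSections_map (p : X ⟶ Spec (CommRingCat.of K)) {U V : X.Opens} (h : U ≤ V) (a : K) :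
    X.presheaf.map (homOfLE h).op (baseToSections p V a) = baseToSections p U a := by
  have h' : ((Scheme.ΓSpecIso (CommRingCat.of K)).inv ≫
        p.appLE ⊤ V (by rw [Scheme.Hom.preimage_top]; exact le_top)) ≫
      X.presheaf.map (homOfLE h).op =
      (Scheme.ΓSpecIso (CommRingCat.of K)).inv ≫
        p.appLE ⊤ U (by rw [Scheme.Hom.preimage_top]; exact le_top) := by
    rw [Category.assoc, Scheme.Hom.appLE_map]
  exact congrArg (fun g => g.hom a) h'

attribute [local instance] MvPolynomial.gradedAlgebra in
/-- The projective space `ℙᴺ` over `K`. -/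
def ProjSpace (K : Type u) [Field K] (N : ℕ) : Scheme.{u} :=
  Proj (MvPolynomial.homogeneousSubmodule (Fin (N + 1)) K)

attribute [local instance] MvPolynomial.gradedAlgebra in
/-- The structure morphism of `ℙᴺ` over `K`. -/
def ProjSpace.structureMorphism (K : Type u) [Field K] (N : ℕ) :
    ProjSpace K N ⟶ Spec (CommRingCat.of K) :=
  Proj.toSpecZero (MvPolynomial.homogeneousSubmodule (Fin (N + 1)) K) ≫
    Spec.map (CommRingCat.ofHom
      (algebraMap K (MvPolynomial.homogeneousSubmodule (Fin (N + 1)) K 0)))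

/-- `X` is projective over `K`: it is a closed subscheme of some `ℙᴺ` over `K`. -/
def IsProjective (p : X ⟶ Spec (CommRingCat.of K)) : Prop :=
  ∃ (N : ℕ) (i : X ⟶ ProjSpace K N),
    IsClosedImmersion i ∧ i ≫ ProjSpace.structureMorphism K N = p

/-- The map `Ω²_{A/k} → Ω²_{B/k}` induced by a map of `k`-algebras `A → B`. -/
def twoFormsMap (k A B : Type u) [CommRing k] [CommRing A] [CommRing B] [Algebra k A]
    [Algebra k B] [Algebra A B] [IsScalarTower k A B] :
    (⋀[A]^2 (Ω[A⁄k])) →ₗ[A] (⋀[B]^2 (Ω[B⁄k])) :=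
  exteriorPower.alternatingMapLinearEquiv
    { ((exteriorPower.ιMulti B 2 (M := Ω[B⁄k])).toMultilinearMap.restrictScalars
        A).compLinearMap (fun _ => KaehlerDifferential.map k k A B) with
      map_eq_zero_of_eq' := fun v _ _ h hij =>
        (exteriorPower.ιMulti B 2 (M := Ω[B⁄k])).map_eq_zero_of_eq
          (fun l => KaehlerDifferential.map k k A B (v l)) (congrArg _ h) hij }

/-- The sheaf of 2-forms `Ω²_{X/K}` is isomorphic to `𝒪_X`: there is a 2-form on `X`, given as
a compatible family of 2-forms on the affine opens, which freely generates all of them. For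
a smooth surface this says that the canonical bundle is trivial. -/
def HasTrivialTwoForms (p : X ⟶ Spec (CommRingCat.of K)) : Prop :=
  letI (U : X.Opens) : Algebra K Γ(X, U) := (baseToSections p U).toAlgebra
  ∃ ω : ∀ U : X.affineOpens, ⋀[Γ(X, U)]^2 (Ω[Γ(X, U)⁄K]),
    (∀ U : X.affineOpens, Function.Bijective fun a : Γ(X, U) => a • ω U) ∧
    ∀ (U V : X.affineOpens) (h : (U : X.Opens) ≤ V),
      letI : Algebra Γ(X, V) Γ(X, U) := (X.presheaf.map (homOfLE h).op).hom.toAlgebra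
      haveI : IsScalarTower K Γ(X, V) Γ(X, U) :=
        IsScalarTower.of_algebraMap_eq fun a => (baseToSections_map p h a).symm
      twoFormsMap K Γ(X, V) Γ(X, U) (ω V) = ω U

/-- The sheaf of abelian groups underlying the structure sheaf. -/
def structureSheafAb (X : Scheme.{u}) :
    Sheaf (Opens.grothendieckTopology X) AddCommGrpCat.{u} :=
  (sheafCompose _ (forget₂ CommRingCat.{u} RingCat.{u} ⋙ forget₂ RingCat.{u} AddCommGrpCat.{u})).obj
    X.sheaf

/-- `p : X ⟶ Spec K` is a projective K3 surface: a smooth, projective, geometrically integral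
surface over `K` with trivial canonical bundle and `H¹(X, 𝒪_X) = 0`. -/
structure IsProjectiveK3Surface (p : X ⟶ Spec (CommRingCat.of K)) : Prop where
  projective : IsProjective p
  geometricallyIntegral : GeometricallyIntegral p
  smooth : SmoothOfRelativeDimension 2 p
  trivialCanonical : HasTrivialTwoForms p
  irregularity : Subsingleton (Sheaf.H.{u} (structureSheafAb X) 1)

end KthreeSurfaces

/-! ### Torsors for split tori -/

section Torsors

/-- The `S`-points of the split torus `𝔾ₘⁿ`, that is, `n`-tuples of invertible functions. -/
abbrev TorusPoints (n : ℕ) (S : Scheme.{u}) : Type u := Fin n → Γ(S, ⊤)ˣ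

/-- Pullback of points of `𝔾ₘⁿ` along a morphism of schemes. -/
def TorusPoints.pullback {n : ℕ} {S S' : Scheme.{u}} (g : S' ⟶ S) (t : TorusPoints n S) :
    TorusPoints n S' :=
  fun i => Units.map (g.appTop.hom : Γ(S, ⊤) →* Γ(S', ⊤)) (t i)

/-- The endomorphism of `𝔾ₘⁿ` with matrix `A` on the co-character lattice `ℤⁿ`,
`(t₁, …, tₙ) ↦ (∏ⱼ tⱼ ^ A₁ⱼ, …, ∏ⱼ tⱼ ^ Aₙⱼ)`, on points with values in a commutative group
of units. It acts on the character lattice `ℤⁿ` by `Aᵀ`. -/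
def torusEnd {n : ℕ} {M : Type*} [CommGroup M] (A : Matrix (Fin n) (Fin n) ℤ) (t : Fin n → M) :
    Fin n → M :=
  fun i => ∏ j, t j ^ A i j

/-- A torsor `E ⟶ X` over the scheme `X` for the split torus `𝔾ₘⁿ`. The action
`𝔾ₘⁿ × E ⟶ E` is given on `S`-points, functorially in the scheme `S`; it is simply transitive on
the fibres of `E ⟶ X`, and `E ⟶ X` has sections locally on `X`. -/
structure TorusTorsor (n : ℕ) (X : Scheme.{u}) where
  /-- The total space. -/
  total : Scheme.{u}
  /-- The projection to the base. -/
  proj : total ⟶ X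
  /-- The action of the torus, on `S`-points. -/
  act : ∀ {S : Scheme.{u}}, TorusPoints n S → (S ⟶ total) → (S ⟶ total)
  act_naturality : ∀ {S S' : Scheme.{u}} (g : S' ⟶ S) (t : TorusPoints n S) (e : S ⟶ total),
    g ≫ act t e = act (t.pullback g) (g ≫ e)
  one_act : ∀ {S : Scheme.{u}} (e : S ⟶ total), act 1 e = e
  mul_act : ∀ {S : Scheme.{u}} (t t' : TorusPoints n S) (e : S ⟶ total),
    act (t * t') e = act t (act t' e)
  act_proj : ∀ {S : Scheme.{u}} (t : TorusPoints n S) (e : S ⟶ total),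
    act t e ≫ proj = e ≫ proj
  simply_transitive : ∀ {S : Scheme.{u}} (e e' : S ⟶ total), e ≫ proj = e' ≫ proj →
    ∃! t : TorusPoints n S, act t e = e'
  locally_trivial : ∀ x : X, ∃ (U : X.Opens) (_ : x ∈ U) (s : (U : Scheme.{u}) ⟶ total),
    s ≫ proj = U.ι

/-- The morphism `F : E ⟶ E` satisfies `F(t · e) = F_𝕋(t) · F(e)`, where `F_𝕋` is the
endomorphism of `𝔾ₘⁿ` with matrix `A` on the co-character lattice. -/
def TorusTorsor.IsEquivariant {n : ℕ} {X : Scheme.{u}} (E : TorusTorsor n X)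
    (F : E.total ⟶ E.total) (A : Matrix (Fin n) (Fin n) ℤ) : Prop :=
  ∀ {S : Scheme.{u}} (t : TorusPoints n S) (e : S ⟶ E.total),
    E.act t e ≫ F = E.act (torusEnd A t) (e ≫ F)

end Torsors

/-! ### Berkovich analytification -/

section Berkovich

variable {K : Type u} [NormedField K] {X Y : Scheme.{u}}

/-- The map `K → κ(x)` given by the structure morphism `p : X ⟶ Spec K`. -/
def baseToResidueField (p : X ⟶ Spec (CommRingCat.of K)) (x : X) : K →+* X.residueField x :=
  (Spec.preimage (X.fromSpecResidueField x ≫ p)).hom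

/-- The Berkovich analytification of the `K`-scheme `p : X ⟶ Spec K`: its points are the points
`x` of `X` with an absolute value on the residue field `κ(x)` which extends the one of `K`.
On an affine chart `Spec A` these are the multiplicative seminorms on `A` extending the norm
of `K`, where `x` is the kernel of the seminorm. -/
@[ext]
structure Analytification (p : X ⟶ Spec (CommRingCat.of K)) where
  /-- The underlying point of the scheme. -/
  pt : X
  /-- The absolute value on the residue field. -/
  abv : AbsoluteValue (X.residueField pt) ℝ
  abv_base : ∀ a : K, abv (baseToResidueField p pt a) = ‖a‖

namespace Analytification

variable {p : X ⟶ Spec (CommRingCat.of K)} {q : Y ⟶ Spec (CommRingCat.of K)}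

/-- The coarsest topology such that, for every open `U` of `X` and every `a ∈ Γ(X, U)`, the set
`Uᵃⁿ` is open and the function `|a| : Uᵃⁿ → ℝ` is continuous. -/
instance : TopologicalSpace (Analytification p) :=
  TopologicalSpace.generateFrom
    {W | ∃ (U : X.Opens) (a : Γ(X, U)) (V : Set ℝ), IsOpen V ∧
      W = {x : Analytification p | ∃ h : x.pt ∈ U, x.abv (X.evaluation U x.pt h a) ∈ V}}

theorem baseToResidueField_map (g : X ⟶ Y) (hg : g ≫ q = p) (x : X) (a : K) :
    (g.residueFieldMap x).hom (baseToResidueField q (g x) a) = baseToResidueField p x a := by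
  have : Spec.preimage (Y.fromSpecResidueField (g x) ≫ q) ≫ g.residueFieldMap x =
      Spec.preimage (X.fromSpecResidueField x ≫ p) := by
    apply Spec.map_injective
    simp [← hg]
  exact congrArg (fun h => h.hom a) this

/-- The map of analytifications induced by a morphism of `K`-schemes. -/
def map (g : X ⟶ Y) (hg : g ≫ q = p) (x : Analytification p) : Analytification q where
  pt := g x.pt
  abv := x.abv.comp (g.residueFieldMap x.pt).hom.injective
  abv_base a := by
    rw [← x.abv_base a, ← baseToResidueField_map g hg]
    rfl

/-- The completed residue field `ℋ(x)`. -/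
abbrev CompletedField (x : Analytification p) : Type u := x.abv.Completion

/-- The canonical map `κ(x) → ℋ(x)`. -/
def toCompletedField (x : Analytification p) : X.residueField x.pt →+* x.CompletedField :=
  (UniformSpace.Completion.coeRingHom (α := WithAbs x.abv)).comp
    (WithAbs.equiv x.abv).symm.toRingHom

theorem norm_toCompletedField (x : Analytification p) (a : X.residueField x.pt) :
    ‖x.toCompletedField a‖ = x.abv a :=
  UniformSpace.Completion.norm_coe (E := WithAbs x.abv) _

/-- The map `ℋ(g(x)) → ℋ(x)` induced by a morphism `g` of `K`-schemes. -/
def completedFieldMap (g : X ⟶ Y) (hg : g ≫ q = p) (x : Analytification p) :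
    (x.map g hg).CompletedField →+* x.CompletedField :=
  UniformSpace.Completion.mapRingHom
    (((WithAbs.equiv x.abv).symm.toRingHom.comp (g.residueFieldMap x.pt).hom).comp
      (WithAbs.equiv (x.map g hg).abv).toRingHom)
    (AddMonoidHomClass.isometry_of_norm _ fun _ => rfl).continuous

/-- The canonical map `κ(x) → ℋ(x)`, as a morphism of commutative rings. -/
def toCompletedFieldHom (x : Analytification p) :
    X.residueField x.pt ⟶ CommRingCat.of x.CompletedField :=
  CommRingCat.ofHom x.toCompletedField

/-- The morphism `Spec ℋ(x) ⟶ X` attached to the point `x` of the analytification. -/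
def fromSpecCompletedField (x : Analytification p) :
    Spec (CommRingCat.of x.CompletedField) ⟶ X :=
  Spec.map x.toCompletedFieldHom ≫ X.fromSpecResidueField x.pt

/-- A point of `X` with values in a normed field `L`, for which the composite `K → L` preserves
norms, gives a point of the analytification. -/
def ofPoint {L : Type u} [NormedField L] (φ : Spec (CommRingCat.of L) ⟶ X)
    (h : ∀ a : K, ‖(Spec.preimage (φ ≫ p)).hom a‖ = ‖a‖) : Analytification p where
  pt := (Scheme.SpecToEquivOfField L X φ).1
  abv := (NormedField.toAbsoluteValue L).comp (Scheme.SpecToEquivOfField L X φ).2.hom.injective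
  abv_base a := by
    have : Spec.preimage (X.fromSpecResidueField _ ≫ p) ≫ (Scheme.SpecToEquivOfField L X φ).2 =
        Spec.preimage (φ ≫ p) := by
      apply Spec.map_injective
      have := (Scheme.SpecToEquivOfField L X).symm_apply_apply φ
      conv_rhs => rw [← this]
      simp [Scheme.SpecToEquivOfField]
    rw [← h a, ← this]
    rfl

theorem norm_preimage_fromSpecCompletedField (x : Analytification p) (a : K) :
    ‖(Spec.preimage (x.fromSpecCompletedField ≫ p)).hom a‖ = ‖a‖ := by
  have : Spec.preimage (x.fromSpecCompletedField ≫ p) =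
      Spec.preimage (X.fromSpecResidueField x.pt ≫ p) ≫ x.toCompletedFieldHom := by
    apply Spec.map_injective
    simp [fromSpecCompletedField]
  rw [← x.abv_base a, ← x.norm_toCompletedField, this]
  rfl

end Analytification

end Berkovich

/-! ### Homogeneous functions on torsors -/

section Homogeneity

variable {K : Type u} [NormedField K] {X : Scheme.{u}} {n : ℕ}

/-- For `e ∈ Eᵃⁿ` over `x ∈ Xᵃⁿ` and `t ∈ 𝕋(ℋ(x))`, the point `t · e` of the fibre of `Eᵃⁿ`
over `x`. It is the point given by `t · ẽ`, where `ẽ : Spec ℋ(e) ⟶ E` is the canonical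
`ℋ(e)`-valued point at `e`, and `t` acts through `ℋ(x) → ℋ(e)`. -/
def TorusTorsor.translate (E : TorusTorsor n X) (p : X ⟶ Spec (CommRingCat.of K))
    (e : Analytification (E.proj ≫ p)) (t : Fin n → ((e.map E.proj rfl).CompletedField)ˣ) :
    Analytification (E.proj ≫ p) :=
  Analytification.ofPoint
    (E.act
      (fun i => Units.map
        (((Scheme.ΓSpecIso (CommRingCat.of e.CompletedField)).inv.hom.comp
          (e.completedFieldMap E.proj rfl) :
          (e.map E.proj rfl).CompletedField →+* Γ(Spec (CommRingCat.of e.CompletedField), ⊤)) :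
          (e.map E.proj rfl).CompletedField →* _) (t i))
      e.fromSpecCompletedField)
    (fun a => by
      rw [← Category.assoc, E.act_proj, Category.assoc]
      exact e.norm_preimage_fromSpecCompletedField a)

/-- `G : Eᵃⁿ → ℝ` is `α`-homogeneous, for `α` in the real character space `ℝⁿ` of `𝔾ₘⁿ`:
`G(t · e) = G(e) + log |α(t)|`, with `log |α(t)| = ∑ᵢ αᵢ log |tᵢ|`, for all `e ∈ Eᵃⁿ` over
`x ∈ Xᵃⁿ` and all `t ∈ 𝕋(ℋ(x))`. -/
def TorusTorsor.IsHomogeneous (E : TorusTorsor n X) (p : X ⟶ Spec (CommRingCat.of K))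
    (α : Fin n → ℝ) (G : Analytification (E.proj ≫ p) → ℝ) : Prop :=
  ∀ (e : Analytification (E.proj ≫ p)) (t : Fin n → ((e.map E.proj rfl).CompletedField)ˣ),
    G (E.translate p e t) =
      G e + ∑ i, α i * Real.log ‖(t i : (e.map E.proj rfl).CompletedField)‖

end Homogeneity

end BerkK3

end

/-!
Two facts carry the proof. First, `X` is proper over `K`, and therefore `Xᵃⁿ` is compact and
Hausdorff (`Analytification.compactSpace`, `Analytification.t2Space`). Both follow from the
valuative criterion: an ultrafilter `𝒰` on `Xᵃⁿ` yields a point of `X` with values in the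
ultraproduct `L` of the fields `ℋ(x)`. The classes of bounded families form a valuation ring `R` of
`L`, whose residue field is normed by the limit of the norms along `𝒰`. An extension of the
`L`-valued point to `Spec R` specializes to a point of `Xᵃⁿ`, and `𝒰` converges to it
(`Analytification.tendsto_ofPoint`); conversely every limit of `𝒰` arises from such an extension
(`Analytification.exists_extension`).

Second, a continuous function on `Eᵃⁿ` which is invariant under the tori `𝕋(ℋ(x))` is bounded
(`TorusTorsor.exists_bound`). Locally on the base, the coordinates of a point of `E` with respect to
a section can be scaled by powers of an element of `K` of absolute value greater than one into a
compact interval, and a family of points with bounded coordinates over a convergent family of base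
points has a limit (`TorusTorsor.exists_tendsto`), again by an ultraproduct argument.

Uniqueness: the difference `D` of two solutions is invariant, hence bounded, and `F^* D = λ D` with
`λ > 1`, so `D = 0`. Existence: a partition of unity on `Xᵃⁿ` glues the functions `log |v(t)|`, with
`t` the coordinates for local sections, to a continuous `v`-homogeneous function `G₀`
(`TorusTorsor.exists_continuous_isStronglyHomogeneous`). Since `v` is an eigenvector, the function
`D = λ⁻¹ F^* G₀ - G₀` is invariant, hence bounded, and `G₀ + ∑ λ⁻ᵐ (Fᵐ)^* D` is the solution.
-/

noncomputable section

namespace BerkK3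

/-! ### Values of functions along morphisms from affine schemes -/

section Values

variable {X Y : Scheme.{u}} {B C : CommRingCat.{u}}

/-- The pullback `φ^* : Γ(X, V) ⟶ B` of functions along a `B`-valued point `φ : Spec B ⟶ X`
that lands in `V`. -/
def valueAt (φ : Spec B ⟶ X) (V : X.Opens) (h : ⊤ ≤ φ ⁻¹ᵁ V) : Γ(X, V) ⟶ B :=
  φ.appLE V ⊤ h ≫ (Scheme.ΓSpecIso B).hom

theorem valueAt_congr {φ ψ : Spec B ⟶ X} (e : φ = ψ) (V : X.Opens) (h : ⊤ ≤ φ ⁻¹ᵁ V)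
    (h' : ⊤ ≤ ψ ⁻¹ᵁ V) : valueAt φ V h = valueAt ψ V h' := by
  subst e; rfl

theorem valueAt_specMap_comp (j : B ⟶ C) (φ : Spec B ⟶ X) (V : X.Opens) (h : ⊤ ≤ φ ⁻¹ᵁ V)
    (h' : ⊤ ≤ (Spec.map j ≫ φ) ⁻¹ᵁ V) :
    valueAt (Spec.map j ≫ φ) V h' = valueAt φ V h ≫ j := by
  rw [valueAt, valueAt, Scheme.Hom.comp_appLE, Scheme.Hom.appLE]
  simp only [Category.assoc]
  rw [← Scheme.ΓSpecIso_naturality j, Scheme.Hom.appTop, Scheme.Hom.app_eq_appLE (f := Spec.map j)]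
  have := (Spec.map j).map_appLE (le_refl ((Spec.map j) ⁻¹ᵁ ⊤)) (homOfLE h).op
  exact congrArg (fun g => φ.app V ≫ g ≫ (Scheme.ΓSpecIso C).hom) this.symm

theorem valueAt_comp (φ : Spec B ⟶ X) (g : X ⟶ Y) (V : Y.Opens) (h : ⊤ ≤ (φ ≫ g) ⁻¹ᵁ V)
    (h' : ⊤ ≤ φ ⁻¹ᵁ (g ⁻¹ᵁ V)) :
    valueAt (φ ≫ g) V h = g.app V ≫ valueAt φ (g ⁻¹ᵁ V) h' := by
  rw [valueAt, valueAt, Scheme.Hom.comp_appLE, Category.assoc]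

theorem map_valueAt (φ : Spec B ⟶ X) {W V : X.Opens} (e : W ≤ V) (h : ⊤ ≤ φ ⁻¹ᵁ W)
    (h' : ⊤ ≤ φ ⁻¹ᵁ V) :
    X.presheaf.map (homOfLE e).op ≫ valueAt φ W h = valueAt φ V h' := by
  rw [valueAt, valueAt, ← Category.assoc, Scheme.Hom.map_appLE]

theorem specMap_valueAt_fromSpec (φ : Spec B ⟶ X) {V : X.Opens} (hV : IsAffineOpen V)
    (h : ⊤ ≤ φ ⁻¹ᵁ V) : Spec.map (valueAt φ V h) ≫ hV.fromSpec = φ := by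
  have := hV.SpecMap_appLE_fromSpec φ (isAffineOpen_top _) h
  rw [IsAffineOpen.fromSpec_top, Iso.eq_inv_comp, Scheme.isoSpec_Spec_hom] at this
  rw [valueAt, Spec.map_comp, Category.assoc]
  exact this

/-- A point with values in an affine open is determined by the pullback of functions. -/
theorem eq_of_valueAt_eq {φ ψ : Spec B ⟶ X} {V : X.Opens} (hV : IsAffineOpen V)
    (h : ⊤ ≤ φ ⁻¹ᵁ V) (h' : ⊤ ≤ ψ ⁻¹ᵁ V) (e : valueAt φ V h = valueAt ψ V h') : φ = ψ := by
  rw [← specMap_valueAt_fromSpec φ hV h, e, specMap_valueAt_fromSpec]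

theorem top_le_preimage_fromSpec {V : X.Opens} (hV : IsAffineOpen V) (ψ : Γ(X, V) ⟶ B) :
    ⊤ ≤ (Spec.map ψ ≫ hV.fromSpec) ⁻¹ᵁ V := by
  intro y _
  change (Spec.map ψ ≫ hV.fromSpec) y ∈ (V : Set X)
  rw [← hV.range_fromSpec]
  exact ⟨Spec.map ψ y, rfl⟩

theorem valueAt_fromSpec {V : X.Opens} (hV : IsAffineOpen V) (ψ : Γ(X, V) ⟶ B)
    (h : ⊤ ≤ (Spec.map ψ ≫ hV.fromSpec) ⁻¹ᵁ V) :
    valueAt (Spec.map ψ ≫ hV.fromSpec) V h = ψ := by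
  have := specMap_valueAt_fromSpec (Spec.map ψ ≫ hV.fromSpec) hV h
  rw [cancel_mono] at this
  exact Spec.map_injective this

theorem top_le_preimage_comp {S T : Scheme.{u}} (g : S ⟶ T) (φ : T ⟶ X) {V : X.Opens}
    (h : ⊤ ≤ φ ⁻¹ᵁ V) : ⊤ ≤ (g ≫ φ) ⁻¹ᵁ V :=
  fun y _ => h (show g y ∈ ⊤ from trivial)

theorem preimage_top_of_subsingleton {L : Type u} [Field L] (φ : Spec (.of L) ⟶ X) {V : X.Opens}
    (y : Spec (CommRingCat.of L)) (h : φ y ∈ V) : ⊤ ≤ φ ⁻¹ᵁ V := by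
  intro z _
  have : z = y := Subsingleton.elim (α := PrimeSpectrum L) _ _
  rw [this]; exact h

theorem top_le_preimage_fromSpecResidueField (x : X) {V : X.Opens} (h : x ∈ V) :
    ⊤ ≤ X.fromSpecResidueField x ⁻¹ᵁ V := by
  intro y _
  change X.fromSpecResidueField x y ∈ V
  rwa [Scheme.fromSpecResidueField_apply]

theorem top_le_preimage_fromSpecStalk {x : X} {V : X.Opens} (h : x ∈ V) :
    ⊤ ≤ X.fromSpecStalk x ⁻¹ᵁ V :=
  (Scheme.preimage_eq_top_of_closedPoint_mem (X.fromSpecStalk x)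
    (by rwa [Scheme.fromSpecStalk_closedPoint])).ge

theorem valueAt_fromSpecStalk {x : X} {V : X.Opens} (hx : x ∈ V) :
    valueAt (X.fromSpecStalk x) V (top_le_preimage_fromSpecStalk hx) =
      X.presheaf.germ V x hx := by
  obtain ⟨_, ⟨W : X.Opens, hW, rfl⟩, hxW, hWV⟩ :=
    X.isBasis_affineOpens.exists_subset_of_mem_open hx V.2
  replace hW : IsAffineOpen W := hW
  replace hWV : W ≤ V := hWV
  have e : X.fromSpecStalk x = Spec.map (X.presheaf.germ W x hxW) ≫ hW.fromSpec :=
    (hW.fromSpecStalk_eq_fromSpecStalk hxW).symm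
  rw [← map_valueAt _ hWV (top_le_preimage_fromSpecStalk hxW),
    valueAt_congr e W _ (top_le_preimage_fromSpec hW _)]
  exact (congrArg _ (valueAt_fromSpec hW _ _)).trans (X.presheaf.germ_res _ _ _)

theorem valueAt_fromSpecResidueField {x : X} {V : X.Opens} (hx : x ∈ V) :
    valueAt (X.fromSpecResidueField x) V (top_le_preimage_fromSpecResidueField x hx) =
      X.evaluation V x hx := by
  refine (valueAt_specMap_comp (X.residue x) (X.fromSpecStalk x) V
    (top_le_preimage_fromSpecStalk hx)
    (top_le_preimage_fromSpecResidueField x hx)).trans ?_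
  rw [valueAt_fromSpecStalk hx]
  rfl

end Values

/-! ### Points and functions on the analytification -/

namespace Analytification

open Filter Topology

variable {K : Type u} [NormedField K] {X Y : Scheme.{u}} {p : X ⟶ Spec (CommRingCat.of K)}
  {q : Y ⟶ Spec (CommRingCat.of K)}

theorem ofPoint_congr {L : Type u} [NormedField L] {φ ψ : Spec (CommRingCat.of L) ⟶ X} (e : φ = ψ)
    (h : ∀ a : K, ‖(Spec.preimage (φ ≫ p)).hom a‖ = ‖a‖)
    (h' : ∀ a : K, ‖(Spec.preimage (ψ ≫ p)).hom a‖ = ‖a‖) : ofPoint φ h = ofPoint ψ h' := by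
  subst e; rfl

/-- If `φ : Spec L ⟶ X` is given by an isometric embedding `κ(x) → L`, then `φ` represents `x`. -/
theorem ofPoint_eq {L : Type u} [NormedField L] (x : Analytification p)
    (j : X.residueField x.pt ⟶ .of L) (hj : ∀ a, ‖(j a : L)‖ = x.abv a)
    (φ : Spec (CommRingCat.of L) ⟶ X) (e : φ = Spec.map j ≫ X.fromSpecResidueField x.pt)
    (h : ∀ a : K, ‖(Spec.preimage (φ ≫ p)).hom a‖ = ‖a‖) : ofPoint φ h = x := by
  have key : Scheme.SpecToEquivOfField L X φ = ⟨x.pt, j⟩ := by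
    rw [e]; exact (Scheme.SpecToEquivOfField L X).right_inv ⟨x.pt, j⟩
  obtain ⟨x, abv, hb⟩ := x
  have main : ∀ (σ : Σ y : X, X.residueField y ⟶ .of L) (_ : σ = ⟨x, j⟩)
      (H : ∀ a : K, (NormedField.toAbsoluteValue L).comp σ.2.hom.injective
        (baseToResidueField p σ.1 a) = ‖a‖),
      (⟨σ.1, (NormedField.toAbsoluteValue L).comp σ.2.hom.injective, H⟩ : Analytification p) =
        ⟨x, abv, hb⟩ := by
    rintro _ rfl H
    congr 1
    ext a
    exact hj a
  exact main _ key _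

theorem specMap_comp_fromSpecResidueField {L : Type u} [NormedField L]
    (φ : Spec (CommRingCat.of L) ⟶ X) :
    Spec.map (Scheme.SpecToEquivOfField L X φ).2 ≫
      X.fromSpecResidueField (Scheme.SpecToEquivOfField L X φ).1 = φ :=
  (Scheme.SpecToEquivOfField L X).left_inv φ

theorem ofPoint_fromSpecCompletedField (x : Analytification p) :
    ofPoint x.fromSpecCompletedField x.norm_preimage_fromSpecCompletedField = x :=
  ofPoint_eq x x.toCompletedFieldHom x.norm_toCompletedField _ rfl _

theorem norm_preimage_comp {L : Type u} [NormedField L] {φ : Spec (CommRingCat.of L) ⟶ X}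
    (h : ∀ a : K, ‖(Spec.preimage (φ ≫ p)).hom a‖ = ‖a‖) {g : X ⟶ Y} (hg : g ≫ q = p) (a : K) :
    ‖(Spec.preimage ((φ ≫ g) ≫ q)).hom a‖ = ‖a‖ := by
  rw [Category.assoc, hg]; exact h a

theorem map_ofPoint {L : Type u} [NormedField L] (φ : Spec (CommRingCat.of L) ⟶ X)
    (h : ∀ a : K, ‖(Spec.preimage (φ ≫ p)).hom a‖ = ‖a‖) (g : X ⟶ Y) (hg : g ≫ q = p) :
    (ofPoint φ h).map g hg = ofPoint (φ ≫ g) (norm_preimage_comp h hg) := by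
  symm
  refine ofPoint_eq ((ofPoint φ h).map g hg)
    (g.residueFieldMap _ ≫ (Scheme.SpecToEquivOfField L X φ).2) (fun _ => rfl) _ ?_ _
  change φ ≫ g = Spec.map (g.residueFieldMap _ ≫ (Scheme.SpecToEquivOfField L X φ).2) ≫
    Y.fromSpecResidueField (g (Scheme.SpecToEquivOfField L X φ).1)
  rw [Spec.map_comp, Category.assoc, Scheme.Hom.SpecMap_residueFieldMap_fromSpecResidueField,
    ← Category.assoc, specMap_comp_fromSpecResidueField]

theorem ofPoint_pt_mem {L : Type u} [NormedField L] {φ : Spec (CommRingCat.of L) ⟶ X}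
    {h : ∀ a : K, ‖(Spec.preimage (φ ≫ p)).hom a‖ = ‖a‖} {V : X.Opens} :
    (ofPoint φ h).pt ∈ V ↔ ⊤ ≤ φ ⁻¹ᵁ V :=
  ⟨fun H => preimage_top_of_subsingleton φ _ H, fun H =>
    H (show IsLocalRing.closedPoint L ∈ (⊤ : (Spec (CommRingCat.of L)).Opens) from trivial)⟩

open Classical in
/-- The function `|a|` on the analytification, for `a ∈ Γ(X, V)`, extended by zero outside of the
analytification of `V`. -/
def absValue (V : X.Opens) (a : Γ(X, V)) (x : Analytification p) : ℝ :=
  if h : x.pt ∈ V then x.abv (X.evaluation V x.pt h a) else 0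

theorem absValue_of_mem {V : X.Opens} (a : Γ(X, V)) {x : Analytification p} (h : x.pt ∈ V) :
    x.absValue V a = x.abv (X.evaluation V x.pt h a) := dif_pos h

theorem absValue_ofPoint {L : Type u} [NormedField L] (φ : Spec (CommRingCat.of L) ⟶ X)
    (h : ∀ a : K, ‖(Spec.preimage (φ ≫ p)).hom a‖ = ‖a‖) {V : X.Opens} (hV : ⊤ ≤ φ ⁻¹ᵁ V)
    (a : Γ(X, V)) : (ofPoint φ h).absValue V a = ‖(valueAt φ V hV a : L)‖ := by
  rw [absValue_of_mem a (ofPoint_pt_mem.2 hV)]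
  have e := specMap_comp_fromSpecResidueField φ
  have hx : (Scheme.SpecToEquivOfField L X φ).1 ∈ V := ofPoint_pt_mem (h := h).2 hV
  have := valueAt_specMap_comp (Scheme.SpecToEquivOfField L X φ).2
    (X.fromSpecResidueField (Scheme.SpecToEquivOfField L X φ).1) V
    (top_le_preimage_fromSpecResidueField _ hx) (by rw [e]; exact hV)
  rw [valueAt_congr e V _ hV, valueAt_fromSpecResidueField hx] at this
  rw [this]
  rfl

theorem absValue_map (g : X ⟶ Y) (hg : g ≫ q = p) (x : Analytification p) (V : Y.Opens)
    (a : Γ(Y, V)) : (x.map g hg).absValue V a = x.absValue (g ⁻¹ᵁ V) (g.app V a) := by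
  by_cases h : g x.pt ∈ V
  · rw [absValue_of_mem a (show (x.map g hg).pt ∈ V from h),
      absValue_of_mem _ (show x.pt ∈ g ⁻¹ᵁ V from h)]
    exact congrArg x.abv (Scheme.evaluation_naturality_apply g x.pt h a)
  · rw [absValue, absValue, dif_neg (show ¬ (x.map g hg).pt ∈ V from h),
      dif_neg (show ¬ x.pt ∈ g ⁻¹ᵁ V from h)]

theorem setOf_absValue_mem_eq (V : X.Opens) (a : Γ(X, V)) (O : Set ℝ) :
    {x : Analytification p | ∃ h : x.pt ∈ V, x.abv (X.evaluation V x.pt h a) ∈ O} =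
      {x | x.pt ∈ V ∧ x.absValue V a ∈ O} := by
  ext x
  constructor
  · rintro ⟨h, H⟩; exact ⟨h, by rwa [absValue_of_mem a h]⟩
  · rintro ⟨h, H⟩; exact ⟨h, by rwa [← absValue_of_mem a h]⟩

theorem isOpen_setOf_absValue_mem (V : X.Opens) (a : Γ(X, V)) {O : Set ℝ} (hO : IsOpen O) :
    IsOpen {x : Analytification p | x.pt ∈ V ∧ x.absValue V a ∈ O} :=
  TopologicalSpace.isOpen_generateFrom_of_mem ⟨V, a, O, hO, (setOf_absValue_mem_eq V a O).symm⟩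

theorem isOpen_setOf_pt_mem (V : X.Opens) : IsOpen {x : Analytification p | x.pt ∈ V} := by
  simpa using isOpen_setOf_absValue_mem (p := p) V 0 isOpen_univ

theorem continuousAt_absValue {V : X.Opens} (a : Γ(X, V)) {x : Analytification p} (h : x.pt ∈ V) :
    ContinuousAt (absValue V a) x := by
  intro O hO
  obtain ⟨O', hO', hO'', hx⟩ := mem_nhds_iff.1 hO
  exact mem_nhds_iff.2 ⟨_, fun y hy => hO' hy.2, isOpen_setOf_absValue_mem V a hO'', h, hx⟩

/-- A family of points converges to `x` as soon as it does so in every chart around `x`. -/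
theorem tendsto_nhds_of_absValue {ι : Type*} {l : Filter ι} {y : ι → Analytification p}
    {x : Analytification p}
    (H : ∀ (V : X.Opens) (a : Γ(X, V)), x.pt ∈ V →
      (∀ᶠ i in l, (y i).pt ∈ V) ∧ Tendsto (fun i => (y i).absValue V a) l (𝓝 (x.absValue V a))) :
    Tendsto y l (𝓝 x) := by
  refine TopologicalSpace.tendsto_nhds_generateFrom_iff.2 ?_
  rintro _ ⟨V, a, O, hO, rfl⟩ hx
  rw [setOf_absValue_mem_eq] at hx ⊢
  obtain ⟨h1, h2⟩ := H V a hx.1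
  filter_upwards [h1, h2 (hO.mem_nhds hx.2)] with i h h' using ⟨h, h'⟩

theorem continuous_map (g : X ⟶ Y) (hg : g ≫ q = p) :
    Continuous fun x : Analytification p => x.map g hg := by
  refine continuous_iff_continuousAt.2 fun x => tendsto_nhds_of_absValue fun V a hx => ⟨?_, ?_⟩
  · exact (isOpen_setOf_pt_mem (p := p) (g ⁻¹ᵁ V)).mem_nhds hx
  · simp only [absValue_map]
    exact continuousAt_absValue _ (show x.pt ∈ g ⁻¹ᵁ V from hx)

theorem absValue_ne_zero_iff {V : X.Opens} (a : Γ(X, V)) {x : Analytification p} (h : x.pt ∈ V) :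
    x.absValue V a ≠ 0 ↔ x.pt ∈ X.basicOpen a := by
  rw [absValue_of_mem a h, x.abv.ne_zero_iff, Scheme.evaluation_ne_zero_iff_mem_basicOpen]

/-- Points of the analytification of an affine open are determined by the values of functions. -/
theorem eq_of_absValue_eq {V : X.Opens} (hV : IsAffineOpen V) {x y : Analytification p}
    (hx : x.pt ∈ V) (hy : y.pt ∈ V) (H : ∀ a, x.absValue V a = y.absValue V a) : x = y := by
  have hpt : x.pt = y.pt := by
    have key : ∀ x y : Analytification p, x.pt ∈ V → y.pt ∈ V →
        (∀ a, x.absValue V a = y.absValue V a) → ∀ O : X.Opens, x.pt ∈ O → y.pt ∈ O := by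
      intro x y hx hy H O hO
      obtain ⟨f, hf, hxf⟩ := hV.exists_basicOpen_le (V := O) ⟨x.pt, hO⟩ hx
      refine hf ((absValue_ne_zero_iff f hy).1 ?_)
      rw [← H]
      exact (absValue_ne_zero_iff f hx).2 hxf
    refine Inseparable.eq (inseparable_iff_forall_isOpen.2 fun O hO => ⟨fun h => ?_, fun h => ?_⟩)
    · exact key x y hx hy H ⟨O, hO⟩ h
    · exact key y x hy hx (fun a => (H a).symm) ⟨O, hO⟩ h
  -- Both absolute values are now on the same residue field, and every element of it is a quotient
  -- of values of functions on `V`.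
  obtain ⟨x, u, hu⟩ := x
  obtain ⟨y, v, hv⟩ := y
  obtain rfl : x = y := hpt
  congr 1
  ext b
  obtain ⟨s, rfl⟩ := X.residue_surjective x b
  have := hV.isLocalization_stalk ⟨x, hx⟩
  let := TopCat.Presheaf.algebra_section_stalk X.presheaf (⟨x, hx⟩ : V)
  obtain ⟨⟨a, c⟩, hac⟩ := IsLocalization.surj
    (M := (hV.primeIdealOf ⟨x, hx⟩).asIdeal.primeCompl) (S := X.presheaf.stalk x) s
  have hc : X.evaluation V x hx (c : Γ(X, V)) ≠ 0 := by
    have := IsLocalization.map_units (X.presheaf.stalk x) c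
    exact (this.map (X.residue x).hom).ne_zero
  have hac' : X.residue x s * X.evaluation V x hx (c : Γ(X, V)) = X.evaluation V x hx a := by
    have := congrArg (X.residue x) hac
    rw [map_mul] at this
    exact this
  have hu' := congrArg u hac'
  have hv' := congrArg v hac'
  rw [map_mul] at hu' hv'
  have ha := H a
  have hc' := H c
  rw [absValue_of_mem _ hx, absValue_of_mem _ hy] at ha hc'
  change u (X.evaluation V x hx a) = v (X.evaluation V x hx a) at ha
  change u (X.evaluation V x hx c) = v (X.evaluation V x hx c) at hc'
  rw [← ha, ← hu', ← hc'] at hv'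
  exact (mul_right_cancel₀ (u.ne_zero hc) hv').symm

end Analytification

/-! ### Ultraproducts of normed fields -/

section Ultraproduct

open Filter Topology

variable {ι : Type u} (𝒰 : Ultrafilter ι) (k : ι → Type u) [∀ i, NormedField (k i)]

/-- The ideal of families that vanish along the ultrafilter. -/
def nullIdeal : Ideal (∀ i, k i) where
  carrier := {f | ∀ᶠ i in 𝒰, f i = 0}
  add_mem' {f g} hf hg := by
    filter_upwards [hf, hg] with i h h'
    rw [Pi.add_apply, h, h', add_zero]
  zero_mem' := Eventually.of_forall fun _ => rfl
  smul_mem' c f hf := by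
    filter_upwards [hf] with i h
    rw [smul_eq_mul, Pi.mul_apply, h, mul_zero]

variable {k} in
theorem mem_nullIdeal {f : ∀ i, k i} : f ∈ nullIdeal 𝒰 k ↔ ∀ᶠ i in 𝒰, f i = 0 := Iff.rfl

instance nullIdeal_isMaximal : (nullIdeal 𝒰 k).IsMaximal := by
  refine Ideal.isMaximal_iff.2 ⟨fun h => ?_, fun J f hJ hf hfJ => ?_⟩
  · obtain ⟨i, hi⟩ := ((mem_nullIdeal 𝒰).1 h).exists
    exact one_ne_zero hi
  · rw [mem_nullIdeal, ← Ultrafilter.eventually_not] at hf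
    have h1 : 1 - f * f⁻¹ ∈ nullIdeal 𝒰 k := by
      filter_upwards [hf] with i hi
      simp [hi]
    have := J.add_mem (hJ h1) (J.mul_mem_right f⁻¹ hfJ)
    rwa [sub_add_cancel] at this

/-- The ultraproduct of the fields `k i`. -/
def Ultraproduct : Type u := (∀ i, k i) ⧸ nullIdeal 𝒰 k

instance : Field (Ultraproduct 𝒰 k) := Ideal.Quotient.field (nullIdeal 𝒰 k)

variable {k} in
/-- The class of a family in the ultraproduct. -/
def ultraMk : (∀ i, k i) →+* Ultraproduct 𝒰 k := Ideal.Quotient.mk (nullIdeal 𝒰 k)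

variable {k}

theorem ultraMk_surjective : Function.Surjective (ultraMk 𝒰 (k := k)) :=
  Ideal.Quotient.mk_surjective

theorem ultraMk_eq_iff {f g : ∀ i, k i} : ultraMk 𝒰 f = ultraMk 𝒰 g ↔ ∀ᶠ i in 𝒰, f i = g i := by
  refine (Ideal.Quotient.eq (I := nullIdeal 𝒰 k)).trans ?_
  rw [mem_nullIdeal]
  simp only [Pi.sub_apply, sub_eq_zero]

theorem ultraMk_ne_zero_iff {f : ∀ i, k i} : ultraMk 𝒰 f ≠ 0 ↔ ∀ᶠ i in 𝒰, f i ≠ 0 := by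
  rw [← map_zero (ultraMk 𝒰), ne_eq, ultraMk_eq_iff, ← Ultrafilter.eventually_not]
  rfl

theorem ultraMk_inv (f : ∀ i, k i) : (ultraMk 𝒰 f)⁻¹ = ultraMk 𝒰 f⁻¹ := by
  by_cases h : ultraMk 𝒰 f = 0
  · rw [h, inv_zero, eq_comm, ← map_zero (ultraMk 𝒰), ultraMk_eq_iff]
    rw [← map_zero (ultraMk 𝒰), ultraMk_eq_iff] at h
    filter_upwards [h] with i hi
    simp [hi]
  · refine (eq_inv_of_mul_eq_one_left ?_).symm
    rw [← map_mul, ← map_one (ultraMk 𝒰), ultraMk_eq_iff]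
    filter_upwards [(ultraMk_ne_zero_iff 𝒰).1 h] with i hi
    simp [hi]

variable (k) in
/-- The valuation ring of those classes in the ultraproduct that are represented by a bounded
family. -/
def boundedClasses : ValuationSubring (Ultraproduct 𝒰 k) where
  carrier := {x | ∃ f : ∀ i, k i, ultraMk 𝒰 f = x ∧ ∃ C : ℝ, ∀ᶠ i in 𝒰, ‖f i‖ ≤ C}
  mul_mem' := by
    rintro _ _ ⟨f, rfl, C, hf⟩ ⟨g, rfl, D, hg⟩
    refine ⟨f * g, map_mul _ _ _, C * D, ?_⟩
    filter_upwards [hf, hg] with i h h'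
    rw [Pi.mul_apply, norm_mul]
    exact mul_le_mul h h' (norm_nonneg _) ((norm_nonneg _).trans h)
  one_mem' := ⟨1, map_one _, 1, Eventually.of_forall fun i => by simp⟩
  add_mem' := by
    rintro _ _ ⟨f, rfl, C, hf⟩ ⟨g, rfl, D, hg⟩
    refine ⟨f + g, map_add _ _ _, C + D, ?_⟩
    filter_upwards [hf, hg] with i h h'
    exact (norm_add_le _ _).trans (add_le_add h h')
  zero_mem' := ⟨0, map_zero _, 0, Eventually.of_forall fun i => by simp⟩
  neg_mem' := by
    rintro _ ⟨f, rfl, C, hf⟩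
    exact ⟨-f, map_neg _ _, C, by simpa using hf⟩
  mem_or_inv_mem' := by
    intro x
    obtain ⟨f, rfl⟩ := ultraMk_surjective 𝒰 x
    rcases 𝒰.em (fun i => ‖f i‖ ≤ 1) with h | h
    · exact Or.inl ⟨f, rfl, 1, h⟩
    · refine Or.inr ⟨f⁻¹, (ultraMk_inv 𝒰 f).symm, 1, ?_⟩
      filter_upwards [h] with i hi
      rw [Pi.inv_apply, norm_inv]
      exact inv_le_one_of_one_le₀ (not_le.1 hi).le

theorem ultraMk_mem_boundedClasses {f : ∀ i, k i} :
    ultraMk 𝒰 f ∈ boundedClasses 𝒰 k ↔ ∃ C : ℝ, ∀ᶠ i in 𝒰, ‖f i‖ ≤ C := by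
  refine ⟨?_, fun h => ⟨f, rfl, h⟩⟩
  rintro ⟨g, hg, C, hC⟩
  refine ⟨C, ?_⟩
  filter_upwards [(ultraMk_eq_iff 𝒰).1 hg, hC] with i h h'
  rwa [← h]

/-- The limit of the norms along the ultrafilter; meaningful only for bounded classes. -/
def limNorm (x : Ultraproduct 𝒰 k) : ℝ :=
  limUnder (𝒰 : Filter ι) fun i => ‖(ultraMk_surjective 𝒰 x).choose i‖

theorem tendsto_limNorm {f : ∀ i, k i} (hf : ultraMk 𝒰 f ∈ boundedClasses 𝒰 k) :
    Tendsto (fun i => ‖f i‖) 𝒰 (𝓝 (limNorm 𝒰 (ultraMk 𝒰 f))) := by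
  set g := (ultraMk_surjective 𝒰 (ultraMk 𝒰 f)).choose with hg
  have e : ultraMk 𝒰 g = ultraMk 𝒰 f := (ultraMk_surjective 𝒰 (ultraMk 𝒰 f)).choose_spec
  obtain ⟨C, hC⟩ := (ultraMk_mem_boundedClasses 𝒰).1 (e ▸ hf)
  have h1 : ∃ a, Tendsto (fun i => ‖g i‖) 𝒰 (𝓝 a) := by
    obtain ⟨a, -, ha⟩ := (isCompact_Icc (a := (0 : ℝ)) (b := C)).ultrafilter_le_nhds
      (𝒰.map fun i => ‖g i‖) (by
        rw [le_principal_iff]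
        exact hC.mono fun i hi => ⟨norm_nonneg _, hi⟩)
    exact ⟨a, ha⟩
  have h2 := tendsto_nhds_limUnder h1
  refine Tendsto.congr' ?_ h2
  filter_upwards [(ultraMk_eq_iff 𝒰).1 e] with i hi
  rw [hi]

theorem limNorm_eq {f : ∀ i, k i} {a : ℝ} (h : Tendsto (fun i => ‖f i‖) 𝒰 (𝓝 a)) :
    limNorm 𝒰 (ultraMk 𝒰 f) = a := by
  refine tendsto_nhds_unique (tendsto_limNorm 𝒰 ?_) h
  exact (ultraMk_mem_boundedClasses 𝒰).2 ⟨a + 1, h.eventually_le_const (lt_add_one a)⟩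

theorem limNorm_mul {x y : Ultraproduct 𝒰 k} (hx : x ∈ boundedClasses 𝒰 k)
    (hy : y ∈ boundedClasses 𝒰 k) : limNorm 𝒰 (x * y) = limNorm 𝒰 x * limNorm 𝒰 y := by
  obtain ⟨f, rfl⟩ := ultraMk_surjective 𝒰 x
  obtain ⟨g, rfl⟩ := ultraMk_surjective 𝒰 y
  rw [← map_mul]
  refine limNorm_eq 𝒰 ?_
  simpa using (tendsto_limNorm 𝒰 hx).mul (tendsto_limNorm 𝒰 hy)

theorem limNorm_add_le {x y : Ultraproduct 𝒰 k} (hx : x ∈ boundedClasses 𝒰 k)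
    (hy : y ∈ boundedClasses 𝒰 k) : limNorm 𝒰 (x + y) ≤ limNorm 𝒰 x + limNorm 𝒰 y := by
  have hxy := add_mem hx hy
  obtain ⟨f, rfl⟩ := ultraMk_surjective 𝒰 x
  obtain ⟨g, rfl⟩ := ultraMk_surjective 𝒰 y
  rw [← map_add] at hxy ⊢
  exact le_of_tendsto_of_tendsto' (tendsto_limNorm 𝒰 hxy)
    ((tendsto_limNorm 𝒰 hx).add (tendsto_limNorm 𝒰 hy)) fun i => norm_add_le _ _

theorem limNorm_nonneg {x : Ultraproduct 𝒰 k} (hx : x ∈ boundedClasses 𝒰 k) :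
    0 ≤ limNorm 𝒰 x := by
  obtain ⟨f, rfl⟩ := ultraMk_surjective 𝒰 x
  exact ge_of_tendsto' (tendsto_limNorm 𝒰 hx) fun i => norm_nonneg _

theorem limNorm_one : limNorm 𝒰 (1 : Ultraproduct 𝒰 k) = 1 := by
  rw [← map_one (ultraMk 𝒰)]
  exact limNorm_eq 𝒰 (by simp)

theorem limNorm_neg {x : Ultraproduct 𝒰 k} (hx : x ∈ boundedClasses 𝒰 k) :
    limNorm 𝒰 (-x) = limNorm 𝒰 x := by
  obtain ⟨f, rfl⟩ := ultraMk_surjective 𝒰 x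
  rw [← map_neg]
  exact limNorm_eq 𝒰 (by simpa using tendsto_limNorm 𝒰 hx)

theorem isUnit_iff_limNorm_ne_zero (r : boundedClasses 𝒰 k) :
    IsUnit r ↔ limNorm 𝒰 (r : Ultraproduct 𝒰 k) ≠ 0 := by
  constructor
  · rintro ⟨⟨r, s, hrs, _⟩, rfl⟩ h
    have h1 := limNorm_mul 𝒰 r.2 s.2
    rw [h, zero_mul] at h1
    have h2 : (r : Ultraproduct 𝒰 k) * s = 1 := congrArg Subtype.val hrs
    rw [h2, limNorm_one] at h1
    exact one_ne_zero h1
  · intro h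
    obtain ⟨r, hr⟩ := r
    obtain ⟨f, rfl⟩ := ultraMk_surjective 𝒰 r
    have hpos : 0 < limNorm 𝒰 (ultraMk 𝒰 f) := lt_of_le_of_ne (limNorm_nonneg 𝒰 hr) (Ne.symm h)
    have hev := (tendsto_limNorm 𝒰 hr).eventually_const_lt (half_lt_self hpos)
    have hf0 : ∀ᶠ i in 𝒰, f i ≠ 0 := hev.mono fun i hi =>
      norm_pos_iff.1 ((half_pos hpos).trans hi)
    have hinv : ultraMk 𝒰 f⁻¹ ∈ boundedClasses 𝒰 k := by
      refine (ultraMk_mem_boundedClasses 𝒰).2 ⟨(limNorm 𝒰 (ultraMk 𝒰 f) / 2)⁻¹, ?_⟩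
      filter_upwards [hev] with i hi
      rw [Pi.inv_apply, norm_inv]
      exact inv_anti₀ (half_pos hpos) hi.le
    refine IsUnit.of_mul_eq_one ⟨_, hinv⟩ (Subtype.ext ?_)
    change ultraMk 𝒰 f * ultraMk 𝒰 f⁻¹ = 1
    rw [← map_mul, ← map_one (ultraMk 𝒰), ultraMk_eq_iff]
    filter_upwards [hf0] with i hi
    simp [hi]

theorem limNorm_eq_of_residue_eq {r s : boundedClasses 𝒰 k}
    (h : IsLocalRing.residue _ r = IsLocalRing.residue _ s) :
    limNorm 𝒰 (r : Ultraproduct 𝒰 k) = limNorm 𝒰 (s : Ultraproduct 𝒰 k) := by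
  have h0 : limNorm 𝒰 ((r - s : boundedClasses 𝒰 k) : Ultraproduct 𝒰 k) = 0 := by
    by_contra hne
    have hu := ((isUnit_iff_limNorm_ne_zero 𝒰 _).2 hne).map (IsLocalRing.residue _)
    rw [map_sub, h, sub_self] at hu
    exact not_isUnit_zero hu
  have h1 := limNorm_add_le 𝒰 (r - s).2 s.2
  have h2 := limNorm_add_le 𝒰 (neg_mem (r - s).2) r.2
  rw [limNorm_neg 𝒰 (r - s).2] at h2
  rw [h0, zero_add] at h1 h2
  rw [show ((r - s : boundedClasses 𝒰 k) : Ultraproduct 𝒰 k) + s = r by push_cast; ring] at h1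
  rw [show -((r - s : boundedClasses 𝒰 k) : Ultraproduct 𝒰 k) + r = s by push_cast; ring] at h2
  exact le_antisymm h1 h2

/-- A representative in the ring of bounded classes of an element of its residue field. -/
def residueRep (z : IsLocalRing.ResidueField (boundedClasses 𝒰 k)) : boundedClasses 𝒰 k :=
  (IsLocalRing.residue_surjective z).choose

theorem residue_residueRep (z : IsLocalRing.ResidueField (boundedClasses 𝒰 k)) :
    IsLocalRing.residue _ (residueRep 𝒰 z) = z :=
  (IsLocalRing.residue_surjective z).choose_spec

variable (k) in
/-- The absolute value that the limit of norms induces on the residue field of the ring of bounded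
classes. -/
def residueAbv : AbsoluteValue (IsLocalRing.ResidueField (boundedClasses 𝒰 k)) ℝ where
  toFun z := limNorm 𝒰 (residueRep 𝒰 z : Ultraproduct 𝒰 k)
  map_mul' x y := by
    rw [← limNorm_mul 𝒰 (residueRep 𝒰 x).2 (residueRep 𝒰 y).2]
    refine limNorm_eq_of_residue_eq 𝒰 (s := residueRep 𝒰 x * residueRep 𝒰 y) ?_
    rw [map_mul]
    simp only [residue_residueRep]
  nonneg' x := limNorm_nonneg 𝒰 (residueRep 𝒰 x).2
  eq_zero' x := by
    rw [← not_iff_not, ← ne_eq, ← isUnit_iff_limNorm_ne_zero,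
      ← IsLocalRing.residue_ne_zero_iff_isUnit, residue_residueRep]
  add_le' x y := by
    refine le_trans (le_of_eq ?_) (limNorm_add_le 𝒰 (residueRep 𝒰 x).2 (residueRep 𝒰 y).2)
    refine limNorm_eq_of_residue_eq 𝒰 (s := residueRep 𝒰 x + residueRep 𝒰 y) ?_
    rw [map_add]
    simp only [residue_residueRep]

variable (k) in
/-- The residue field of the ring of bounded classes, normed by the limit of norms. -/
def LimitField : Type u := WithAbs (residueAbv 𝒰 k)

instance : NormedField (LimitField 𝒰 k) := WithAbs.normedField (residueAbv 𝒰 k)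

variable (k) in
/-- The reduction map from the ring of bounded classes to its normed residue field. -/
def toLimitField : boundedClasses 𝒰 k →+* LimitField 𝒰 k :=
  ((WithAbs.equiv (residueAbv 𝒰 k)).symm.toRingHom.comp (IsLocalRing.residue _) :
    boundedClasses 𝒰 k →+* WithAbs (residueAbv 𝒰 k))

theorem norm_toLimitField (r : boundedClasses 𝒰 k) :
    ‖toLimitField 𝒰 k r‖ = limNorm 𝒰 (r : Ultraproduct 𝒰 k) :=
  limNorm_eq_of_residue_eq 𝒰 (residue_residueRep 𝒰 _)

variable (k) in
/-- The ring of families that are bounded along the ultrafilter. -/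
def boundedFamilies : Subring (∀ i, k i) :=
  (boundedClasses 𝒰 k).toSubring.comap (ultraMk 𝒰)

theorem mem_boundedFamilies {f : ∀ i, k i} :
    f ∈ boundedFamilies 𝒰 k ↔ ∃ C : ℝ, ∀ᶠ i in 𝒰, ‖f i‖ ≤ C :=
  ultraMk_mem_boundedClasses 𝒰

variable (k) in
/-- The class of a bounded family. -/
def boundedMk : boundedFamilies 𝒰 k →+* boundedClasses 𝒰 k :=
  ((ultraMk 𝒰).comp (boundedFamilies 𝒰 k).subtype).codRestrict (boundedClasses 𝒰 k).toSubring
    fun f => f.2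

end Ultraproduct

/-! ### Ultraproducts of points of a scheme -/

section UltraPoints

open Filter Topology

variable {ι : Type u} (𝒰 : Ultrafilter ι) {k : ι → Type u} [∀ i, NormedField (k i)]
  {X Y : Scheme.{u}}

open Classical in
/-- The values of a function on `V` at a family of points, with the value `0` at the points
outside of `V`. -/
def valueFamily (φ : ∀ i, Spec (CommRingCat.of (k i)) ⟶ X) (V : X.Opens) (a : Γ(X, V)) :
    ∀ i, k i :=
  fun i => if h : ⊤ ≤ φ i ⁻¹ᵁ V then valueAt (φ i) V h a else 0

theorem valueFamily_apply {φ : ∀ i, Spec (CommRingCat.of (k i)) ⟶ X} {V : X.Opens} (a : Γ(X, V))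
    {i : ι} (h : ⊤ ≤ φ i ⁻¹ᵁ V) : valueFamily φ V a i = valueAt (φ i) V h a := dif_pos h

/-- The values in the ultraproduct of functions on `V`, for a family of points which lie in `V`
along the ultrafilter. -/
def ultraValue {φ : ∀ i, Spec (CommRingCat.of (k i)) ⟶ X} {V : X.Opens}
    (h : ∀ᶠ i in 𝒰, ⊤ ≤ φ i ⁻¹ᵁ V) : Γ(X, V) →+* Ultraproduct 𝒰 k where
  toFun a := ultraMk 𝒰 (valueFamily φ V a)
  map_one' := by
    rw [← map_one (ultraMk 𝒰), ultraMk_eq_iff]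
    filter_upwards [h] with i hi
    rw [valueFamily_apply _ hi, map_one]; rfl
  map_zero' := by
    rw [← map_zero (ultraMk 𝒰), ultraMk_eq_iff]
    filter_upwards [h] with i hi
    rw [valueFamily_apply _ hi, map_zero]; rfl
  map_mul' a b := by
    rw [← map_mul (ultraMk 𝒰), ultraMk_eq_iff]
    filter_upwards [h] with i hi
    rw [Pi.mul_apply]
    simp only [valueFamily_apply _ hi, map_mul]
  map_add' a b := by
    rw [← map_add (ultraMk 𝒰), ultraMk_eq_iff]
    filter_upwards [h] with i hi
    rw [Pi.add_apply]
    simp only [valueFamily_apply _ hi, map_add]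

/-- The point `Spec L ⟶ X` with values in the ultraproduct `L` which is defined by a family of
points lying in an affine open along the ultrafilter. -/
def ultraPoint {φ : ∀ i, Spec (CommRingCat.of (k i)) ⟶ X} {V : X.Opens} (hV : IsAffineOpen V)
    (h : ∀ᶠ i in 𝒰, ⊤ ≤ φ i ⁻¹ᵁ V) : Spec (CommRingCat.of (Ultraproduct 𝒰 k)) ⟶ X :=
  Spec.map (CommRingCat.ofHom (ultraValue 𝒰 h)) ≫ hV.fromSpec

/-- The `L`-valued point `τ`, for `L` the ultraproduct, is the limit of the family `φ`: if it lies
in an open `W`, then so does the family along the ultrafilter, and the functions on `W` have the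
expected values. -/
def IsUltraPoint (τ : Spec (CommRingCat.of (Ultraproduct 𝒰 k)) ⟶ X)
    (φ : ∀ i, Spec (CommRingCat.of (k i)) ⟶ X) : Prop :=
  ∀ (W : X.Opens) (h : ⊤ ≤ τ ⁻¹ᵁ W), (∀ᶠ i in 𝒰, ⊤ ≤ φ i ⁻¹ᵁ W) ∧
    ∀ b, (valueAt τ W h b : Ultraproduct 𝒰 k) = ultraMk 𝒰 (valueFamily φ W b)

variable {𝒰}

theorem ultraMk_valueFamily_res {φ : ∀ i, Spec (CommRingCat.of (k i)) ⟶ X} {W V : X.Opens}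
    (e : W ≤ V) (h : ∀ᶠ i in 𝒰, ⊤ ≤ φ i ⁻¹ᵁ W) (a : Γ(X, V)) :
    ultraMk 𝒰 (valueFamily φ W (X.presheaf.map (homOfLE e).op a)) =
      ultraMk 𝒰 (valueFamily φ V a) := by
  rw [ultraMk_eq_iff]
  filter_upwards [h] with i hi
  have hi' : ⊤ ≤ φ i ⁻¹ᵁ V := hi.trans fun y hy => e hy
  rw [valueFamily_apply _ hi, valueFamily_apply _ hi', ← map_valueAt (φ i) e hi hi']
  rfl

/-- The point of the ultraproduct does not depend on the affine chart. -/
theorem ultraPoint_eq_of_le {φ : ∀ i, Spec (CommRingCat.of (k i)) ⟶ X} {W V : X.Opens}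
    (hW : IsAffineOpen W) (hV : IsAffineOpen V) (e : W ≤ V) (h : ∀ᶠ i in 𝒰, ⊤ ≤ φ i ⁻¹ᵁ W)
    (h' : ∀ᶠ i in 𝒰, ⊤ ≤ φ i ⁻¹ᵁ V) : ultraPoint 𝒰 hW h = ultraPoint 𝒰 hV h' := by
  have hWτ : ⊤ ≤ ultraPoint 𝒰 hW h ⁻¹ᵁ W := top_le_preimage_fromSpec hW _
  refine eq_of_valueAt_eq hV (hWτ.trans fun y hy => e hy) (top_le_preimage_fromSpec hV _) ?_
  rw [← map_valueAt _ e hWτ]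
  refine Eq.trans ?_ (valueAt_fromSpec hV _ _).symm
  refine (congrArg _ (valueAt_fromSpec hW _ _)).trans ?_
  ext a
  exact ultraMk_valueFamily_res e h a

theorem top_le_preimage_basicOpen {L : Type u} [Field L] {φ : Spec (CommRingCat.of L) ⟶ X}
    {V : X.Opens} (h : ⊤ ≤ φ ⁻¹ᵁ V) (f : Γ(X, V)) (hf : (valueAt φ V h f : L) ≠ 0) :
    ⊤ ≤ φ ⁻¹ᵁ X.basicOpen f := by
  have h1 : IsUnit (valueAt φ V h f) := IsUnit.mk0 _ hf
  have h2 : IsUnit (φ.appLE V ⊤ h f) := by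
    have := h1.map (Scheme.ΓSpecIso (CommRingCat.of L)).inv.hom
    simpa [valueAt] using this
  have h3 := Scheme.basicOpen_appLE φ ⊤ V h f
  rw [Scheme.basicOpen_of_isUnit _ h2] at h3
  exact h3.le.trans inf_le_right

theorem valueAt_ne_zero {L : Type u} [Field L] {φ : Spec (CommRingCat.of L) ⟶ X}
    {V : X.Opens} (h : ⊤ ≤ φ ⁻¹ᵁ V) (f : Γ(X, V)) (hf : ⊤ ≤ φ ⁻¹ᵁ X.basicOpen f) :
    (valueAt φ V h f : L) ≠ 0 := by
  rw [← map_valueAt φ (X.basicOpen_le f) hf h]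
  exact ((X.toRingedSpace.isUnit_res_basicOpen f).map (valueAt φ _ hf).hom).ne_zero

theorem isUltraPoint_ultraPoint {φ : ∀ i, Spec (CommRingCat.of (k i)) ⟶ X} {V : X.Opens}
    (hV : IsAffineOpen V) (h : ∀ᶠ i in 𝒰, ⊤ ≤ φ i ⁻¹ᵁ V) :
    IsUltraPoint 𝒰 (ultraPoint 𝒰 hV h) φ := by
  intro W hW
  have hVτ : ⊤ ≤ ultraPoint 𝒰 hV h ⁻¹ᵁ V := top_le_preimage_fromSpec hV _
  let y : Spec (CommRingCat.of (Ultraproduct 𝒰 k)) :=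
    IsLocalRing.closedPoint (Ultraproduct 𝒰 k)
  -- A basic open of `V` around the image of the point is a chart inside of `W`.
  obtain ⟨f, hfW, hyf⟩ := hV.exists_basicOpen_le (V := W)
    ⟨ultraPoint 𝒰 hV h y, hW (show y ∈ (⊤ : Scheme.Opens _) from trivial)⟩
    (hVτ (show y ∈ (⊤ : Scheme.Opens _) from trivial))
  have hfτ := preimage_top_of_subsingleton _ y hyf
  have hne := valueAt_ne_zero hVτ f hfτ
  have hval : valueAt (ultraPoint 𝒰 hV h) V hVτ f = ultraMk 𝒰 (valueFamily φ V f) :=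
    congrArg (fun g => g.hom f) (valueAt_fromSpec hV (CommRingCat.ofHom (ultraValue 𝒰 h)) hVτ)
  rw [hval, ultraMk_ne_zero_iff] at hne
  have hf : ∀ᶠ i in 𝒰, ⊤ ≤ φ i ⁻¹ᵁ X.basicOpen f := by
    filter_upwards [h, hne] with i hi hi'
    rw [valueFamily_apply _ hi] at hi'
    exact top_le_preimage_basicOpen hi f hi'
  refine ⟨hf.mono fun i hi => hi.trans fun y hy => hfW hy, fun b => ?_⟩
  have e := ultraPoint_eq_of_le (hV.basicOpen f) hV (X.basicOpen_le f) hf h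
  rw [← map_valueAt _ hfW hfτ, ← ultraMk_valueFamily_res hfW hf b,
    ← valueAt_congr e _ (top_le_preimage_fromSpec (hV.basicOpen f) _)]
  exact congrArg (fun g => g.hom (X.presheaf.map (homOfLE hfW).op b))
    (valueAt_fromSpec (hV.basicOpen f) (CommRingCat.ofHom (ultraValue 𝒰 hf)) _)

/-- Limit points with values in the ultraproduct are preserved by morphisms. -/
theorem IsUltraPoint.comp {τ : Spec (CommRingCat.of (Ultraproduct 𝒰 k)) ⟶ X}
    {φ : ∀ i, Spec (CommRingCat.of (k i)) ⟶ X} (H : IsUltraPoint 𝒰 τ φ) (g : X ⟶ Y) :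
    IsUltraPoint 𝒰 (τ ≫ g) fun i => φ i ≫ g := by
  intro W h
  obtain ⟨h1, h2⟩ := H (g ⁻¹ᵁ W) h
  refine ⟨h1, fun b => ?_⟩
  rw [valueAt_comp τ g W h h]
  refine (h2 (g.app W b)).trans ((ultraMk_eq_iff 𝒰).2 ?_)
  filter_upwards [h1] with i hi
  have hi' : ⊤ ≤ (φ i ≫ g) ⁻¹ᵁ W := hi
  rw [valueFamily_apply _ hi, valueFamily_apply (φ := fun i => φ i ≫ g) _ hi',
    valueAt_comp (φ i) g W hi' hi]
  rfl

/-- A morphism from the ultraproduct to an affine scheme which is the limit of a family of points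
is given by the ultraproduct of the ring homomorphisms. -/
theorem IsUltraPoint.eq_specMap {A : CommRingCat.{u}}
    {τ : Spec (CommRingCat.of (Ultraproduct 𝒰 k)) ⟶ Spec A}
    {φ : ∀ i, Spec (CommRingCat.of (k i)) ⟶ Spec A} (H : IsUltraPoint 𝒰 τ φ)
    (ψ : A →+* ∀ i, k i)
    (hψ : ∀ i, φ i = Spec.map (CommRingCat.ofHom ((Pi.evalRingHom k i).comp ψ))) :
    τ = Spec.map (CommRingCat.ofHom ((ultraMk 𝒰).comp ψ)) := by
  have key {B : CommRingCat.{u}} (j : A ⟶ B) : valueAt (Spec.map j) ⊤ le_top =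
      valueAt (𝟙 (Spec A)) ⊤ le_top ≫ j := by
    rw [← valueAt_specMap_comp j (𝟙 (Spec A)) ⊤ le_top le_top]
    exact valueAt_congr (Category.comp_id _).symm _ _ _
  refine eq_of_valueAt_eq (isAffineOpen_top _) le_top le_top ?_
  rw [key]
  ext b
  refine ((H ⊤ le_top).2 b).trans ?_
  refine congrArg (ultraMk 𝒰) (funext fun i => ?_)
  refine (valueFamily_apply b (le_top : ⊤ ≤ φ i ⁻¹ᵁ ⊤)).trans ?_
  exact congrArg (fun g => g.hom b) ((valueAt_congr (hψ i) ⊤ le_top le_top).trans (key _))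

/-- A family of points that lie in a quasi-compact open lies in a single affine open along the
ultrafilter. -/
theorem exists_isAffineOpen_eventually (φ : ∀ i, Spec (CommRingCat.of (k i)) ⟶ X) {C : X.Opens}
    (hC : IsCompact (C : Set X)) (h : ∀ᶠ i in 𝒰, ⊤ ≤ φ i ⁻¹ᵁ C) :
    ∃ W : X.Opens, IsAffineOpen W ∧ W ≤ C ∧ ∀ᶠ i in 𝒰, ⊤ ≤ φ i ⁻¹ᵁ W := by
  let y (i : ι) : X := φ i (IsLocalRing.closedPoint (k i))
  obtain ⟨z, hz, hyz⟩ := hC.ultrafilter_le_nhds (𝒰.map y) (by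
    rw [le_principal_iff]
    exact h.mono fun i hi => hi (show IsLocalRing.closedPoint (k i) ∈ (⊤ : Set _) from trivial))
  obtain ⟨_, ⟨W : X.Opens, hW, rfl⟩, hzW, hWC⟩ :=
    X.isBasis_affineOpens.exists_subset_of_mem_open hz C.2
  refine ⟨W, hW, hWC, ?_⟩
  filter_upwards [hyz (W.2.mem_nhds hzW)] with i hi
  exact preimage_top_of_subsingleton _ _ hi

end UltraPoints

/-! ### The analytification of a proper scheme is compact and Hausdorff -/

namespace Analytification

open Filter Topology

variable {K : Type u} [NormedField K] {X Y : Scheme.{u}} {p : X ⟶ Spec (CommRingCat.of K)}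
  {q : Y ⟶ Spec (CommRingCat.of K)}
  {ι : Type u} {𝒰 : Ultrafilter ι} {k : ι → Type u} [∀ i, NormedField (k i)]

/-- The homomorphism from the ground field to the product of the fields of a family of points. -/
def baseToProd (p : X ⟶ Spec (CommRingCat.of K)) (φ : ∀ i, Spec (CommRingCat.of (k i)) ⟶ X) :
    K →+* ∀ i, k i :=
  RingHom.pi fun i => (Spec.preimage (φ i ≫ p)).hom

theorem isUltraPoint_comp_structure {φ : ∀ i, Spec (CommRingCat.of (k i)) ⟶ X}
    {τ : Spec (CommRingCat.of (Ultraproduct 𝒰 k)) ⟶ X} (H : IsUltraPoint 𝒰 τ φ) :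
    τ ≫ p = Spec.map (CommRingCat.ofHom ((ultraMk 𝒰).comp (baseToProd p φ))) :=
  (H.comp p).eq_specMap (baseToProd p φ) fun i => (Spec.map_preimage (φ i ≫ p)).symm

variable (𝒰) in
/-- The homomorphism from the ground field to the ring of bounded classes in the ultraproduct. -/
def baseToBounded {φ : ∀ i, Spec (CommRingCat.of (k i)) ⟶ X}
    (hφ : ∀ i, ∀ a : K, ‖(Spec.preimage (φ i ≫ p)).hom a‖ = ‖a‖) :
    K →+* boundedClasses 𝒰 k :=
  ((ultraMk 𝒰).comp (baseToProd p φ)).codRestrict (boundedClasses 𝒰 k).toSubring fun a =>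
    (ultraMk_mem_boundedClasses 𝒰).2 ⟨‖a‖, Eventually.of_forall fun i => (hφ i a).le⟩

theorem norm_baseToBounded {φ : ∀ i, Spec (CommRingCat.of (k i)) ⟶ X}
    (hφ : ∀ i, ∀ a : K, ‖(Spec.preimage (φ i ≫ p)).hom a‖ = ‖a‖) (a : K) :
    ‖toLimitField 𝒰 k (baseToBounded 𝒰 hφ a)‖ = ‖a‖ := by
  rw [norm_toLimitField]
  refine limNorm_eq 𝒰 (f := baseToProd p φ a) ?_
  refine tendsto_const_nhds.congr fun i => ?_
  exact (hφ i a).symm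

variable (𝒰 k) in
/-- The inclusion of the generic point of the spectrum of the ring of bounded classes. -/
def boundedGeneric : Spec (CommRingCat.of (Ultraproduct 𝒰 k)) ⟶
    Spec (CommRingCat.of (boundedClasses 𝒰 k)) :=
  Spec.map (CommRingCat.ofHom (boundedClasses 𝒰 k).subtype)

variable (𝒰 k) in
/-- The closed point of the spectrum of the ring of bounded classes. -/
def boundedSpecial : Spec (CommRingCat.of (LimitField 𝒰 k)) ⟶
    Spec (CommRingCat.of (boundedClasses 𝒰 k)) :=
  Spec.map (CommRingCat.ofHom (toLimitField 𝒰 k))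

theorem valueAt_boundedGeneric {l : Spec (CommRingCat.of (boundedClasses 𝒰 k)) ⟶ X} {V : X.Opens}
    (h : ⊤ ≤ l ⁻¹ᵁ V) (h' : ⊤ ≤ (boundedGeneric 𝒰 k ≫ l) ⁻¹ᵁ V) (a : Γ(X, V)) :
    (valueAt (boundedGeneric 𝒰 k ≫ l) V h' a : Ultraproduct 𝒰 k) =
      (boundedClasses 𝒰 k).subtype (valueAt l V h a) :=
  congrArg (fun g : Γ(X, V) ⟶ CommRingCat.of (Ultraproduct 𝒰 k) => g a)
    (valueAt_specMap_comp (CommRingCat.ofHom (boundedClasses 𝒰 k).subtype) l V h h')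

theorem valueAt_boundedSpecial {l : Spec (CommRingCat.of (boundedClasses 𝒰 k)) ⟶ X} {V : X.Opens}
    (h : ⊤ ≤ l ⁻¹ᵁ V) (h' : ⊤ ≤ (boundedSpecial 𝒰 k ≫ l) ⁻¹ᵁ V) (a : Γ(X, V)) :
    (valueAt (boundedSpecial 𝒰 k ≫ l) V h' a : LimitField 𝒰 k) =
      toLimitField 𝒰 k (valueAt l V h a) :=
  congrArg (fun g : Γ(X, V) ⟶ CommRingCat.of (LimitField 𝒰 k) => g a)
    (valueAt_specMap_comp (CommRingCat.ofHom (toLimitField 𝒰 k)) l V h h')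

theorem boundedGeneric_specMap_baseToBounded {φ : ∀ i, Spec (CommRingCat.of (k i)) ⟶ X}
    (hφ : ∀ i, ∀ a : K, ‖(Spec.preimage (φ i ≫ p)).hom a‖ = ‖a‖) :
    boundedGeneric 𝒰 k ≫ Spec.map (CommRingCat.ofHom (baseToBounded 𝒰 hφ)) =
      Spec.map (CommRingCat.ofHom ((ultraMk 𝒰).comp (baseToProd p φ))) := by
  rw [boundedGeneric, ← Spec.map_comp]
  rfl

/-- An extension of the limit point to the ring of bounded classes is a morphism over the ground
field, because it is one at the generic point. -/
theorem comp_structure_of_generic {φ : ∀ i, Spec (CommRingCat.of (k i)) ⟶ X}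
    (hφ : ∀ i, ∀ a : K, ‖(Spec.preimage (φ i ≫ p)).hom a‖ = ‖a‖)
    {l : Spec (CommRingCat.of (boundedClasses 𝒰 k)) ⟶ X}
    (H : IsUltraPoint 𝒰 (boundedGeneric 𝒰 k ≫ l) φ) :
    l ≫ p = Spec.map (CommRingCat.ofHom (baseToBounded 𝒰 hφ)) := by
  have h1 : boundedGeneric 𝒰 k ≫ l ≫ p =
      boundedGeneric 𝒰 k ≫ Spec.map (CommRingCat.ofHom (baseToBounded 𝒰 hφ)) := by
    rw [← Category.assoc, boundedGeneric_specMap_baseToBounded]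
    exact isUltraPoint_comp_structure H
  rw [← Spec.map_preimage (l ≫ p), boundedGeneric, ← Spec.map_comp, ← Spec.map_comp] at h1
  rw [← Spec.map_preimage (l ≫ p)]
  congr 1
  ext a
  have h2 : ((Spec.preimage (l ≫ p)).hom a : Ultraproduct 𝒰 k) = baseToBounded 𝒰 hφ a :=
    congrArg (fun g => (g.hom a : Ultraproduct 𝒰 k)) (Spec.map_injective h1)
  exact h2

theorem norm_boundedSpecial {φ : ∀ i, Spec (CommRingCat.of (k i)) ⟶ X}
    (hφ : ∀ i, ∀ a : K, ‖(Spec.preimage (φ i ≫ p)).hom a‖ = ‖a‖)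
    {l : Spec (CommRingCat.of (boundedClasses 𝒰 k)) ⟶ X}
    (hl : l ≫ p = Spec.map (CommRingCat.ofHom (baseToBounded 𝒰 hφ))) (a : K) :
    ‖(Spec.preimage ((boundedSpecial 𝒰 k ≫ l) ≫ p)).hom a‖ = ‖a‖ := by
  rw [Category.assoc, hl, boundedSpecial, ← Spec.map_comp, Spec.preimage_map]
  exact norm_baseToBounded hφ a

/-- If the limit point with values in the ultraproduct extends to the ring of bounded classes, then
the family of points converges to the specialization. -/
theorem tendsto_ofPoint {φ : ∀ i, Spec (CommRingCat.of (k i)) ⟶ X}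
    (hφ : ∀ i, ∀ a : K, ‖(Spec.preimage (φ i ≫ p)).hom a‖ = ‖a‖)
    {l : Spec (CommRingCat.of (boundedClasses 𝒰 k)) ⟶ X}
    (H : IsUltraPoint 𝒰 (boundedGeneric 𝒰 k ≫ l) φ)
    (h : ∀ a : K, ‖(Spec.preimage ((boundedSpecial 𝒰 k ≫ l) ≫ p)).hom a‖ = ‖a‖) :
    Tendsto (fun i => ofPoint (φ i) (hφ i)) 𝒰 (𝓝 (ofPoint (boundedSpecial 𝒰 k ≫ l) h)) := by
  refine tendsto_nhds_of_absValue fun V a hV => ?_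
  rw [ofPoint_pt_mem] at hV
  have hlV : ⊤ ≤ l ⁻¹ᵁ V := by
    refine (Scheme.preimage_eq_top_of_closedPoint_mem
      (R := CommRingCat.of (boundedClasses 𝒰 k)) l ?_).ge
    have : IsLocalHom (toLimitField 𝒰 k) := by
      constructor
      intro r hr
      rw [isUnit_iff_limNorm_ne_zero, ← norm_toLimitField]
      exact norm_ne_zero_iff.2 hr.ne_zero
    have h1 := IsLocalRing.comap_closedPoint (toLimitField 𝒰 k)
    rw [← h1]
    exact hV (show IsLocalRing.closedPoint (LimitField 𝒰 k) ∈ (⊤ : Set _) from trivial)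
  obtain ⟨h1, h2⟩ := H V (top_le_preimage_comp _ _ hlV)
  refine ⟨h1.mono fun i hi => ofPoint_pt_mem.2 hi, ?_⟩
  rw [absValue_ofPoint _ h hV]
  set r : boundedClasses 𝒰 k := valueAt l V hlV a with hr
  have h5 : (r : Ultraproduct 𝒰 k) = ultraMk 𝒰 (valueFamily φ V a) :=
    (valueAt_boundedGeneric hlV (top_le_preimage_comp _ _ hlV) a).symm.trans (h2 a)
  have h6 : (valueAt (boundedSpecial 𝒰 k ≫ l) V hV a : LimitField 𝒰 k) = toLimitField 𝒰 k r :=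
    valueAt_boundedSpecial hlV hV a
  rw [h6, norm_toLimitField, h5]
  refine (tendsto_limNorm 𝒰 (h5 ▸ r.2)).congr' ?_
  filter_upwards [h1] with i hi
  rw [absValue_ofPoint _ _ hi, valueFamily_apply a hi]

/-- The valuative square of a family of points. -/
def ultraSquare {φ : ∀ i, Spec (CommRingCat.of (k i)) ⟶ X}
    (hφ : ∀ i, ∀ a : K, ‖(Spec.preimage (φ i ≫ p)).hom a‖ = ‖a‖)
    {τ : Spec (CommRingCat.of (Ultraproduct 𝒰 k)) ⟶ X} (H : IsUltraPoint 𝒰 τ φ) :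
    ValuativeCommSq p where
  R := boundedClasses 𝒰 k
  K := Ultraproduct 𝒰 k
  i₁ := τ
  i₂ := Spec.map (CommRingCat.ofHom (baseToBounded 𝒰 hφ))
  commSq := ⟨(isUltraPoint_comp_structure H).trans (boundedGeneric_specMap_baseToBounded hφ).symm⟩

/-- The valuative criterion gives limits of ultrafilters of points. -/
theorem compactSpace [UniversallyClosed p] : CompactSpace (Analytification p) := by
  have hp : (ValuativeCriterion.Existence ⊓ @QuasiCompact) p := by
    rw [← UniversallyClosed.eq_valuativeCriterion]; infer_instance
  have : QuasiCompact p := hp.2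
  have : CompactSpace X := QuasiCompact.compactSpace_of_compactSpace p
  refine ⟨isCompact_iff_ultrafilter_le_nhds.2 fun 𝒰 _ => ?_⟩
  let φ (x : Analytification p) := x.fromSpecCompletedField
  have hφ (x : Analytification p) := x.norm_preimage_fromSpecCompletedField
  obtain ⟨W, hW, -, hev⟩ := exists_isAffineOpen_eventually (𝒰 := 𝒰) φ (C := ⊤) isCompact_univ
    (Eventually.of_forall fun _ => le_top)
  have H := isUltraPoint_ultraPoint hW hev
  obtain ⟨⟨l, hl1, hl2⟩⟩ := (hp.1 (ultraSquare hφ H)).exists_lift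
  replace hl1 : boundedGeneric 𝒰 _ ≫ l = ultraPoint 𝒰 hW hev := hl1
  have hlim := tendsto_ofPoint hφ (l := l) (by rw [hl1]; exact H) (norm_boundedSpecial hφ hl2)
  simp only [ofPoint_fromSpecCompletedField] at hlim
  exact ⟨ofPoint _ (norm_boundedSpecial hφ hl2), Set.mem_univ _, hlim⟩

/-- If a family of points converges, then its limit with values in the ultraproduct extends to the
ring of bounded classes, and specializes to the limit point. -/
theorem exists_extension {φ : ∀ i, Spec (CommRingCat.of (k i)) ⟶ X}
    (hφ : ∀ i, ∀ a : K, ‖(Spec.preimage (φ i ≫ p)).hom a‖ = ‖a‖) {x : Analytification p}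
    (hx : Tendsto (fun i => ofPoint (φ i) (hφ i)) 𝒰 (𝓝 x)) {V : X.Opens} (hV : IsAffineOpen V)
    (hxV : x.pt ∈ V) (hev : ∀ᶠ i in 𝒰, ⊤ ≤ φ i ⁻¹ᵁ V) :
    ∃ (l : Spec (CommRingCat.of (boundedClasses 𝒰 k)) ⟶ X)
      (hl : l ≫ p = Spec.map (CommRingCat.ofHom (baseToBounded 𝒰 hφ))),
      boundedGeneric 𝒰 k ≫ l = ultraPoint 𝒰 hV hev ∧
      ofPoint (boundedSpecial 𝒰 k ≫ l) (norm_boundedSpecial hφ hl) = x := by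
  have hlim (a : Γ(X, V)) : Tendsto (fun i => ‖valueFamily φ V a i‖) 𝒰 (𝓝 (x.absValue V a)) := by
    refine ((continuousAt_absValue a hxV).tendsto.comp hx).congr' ?_
    filter_upwards [hev] with i hi
    rw [Function.comp_apply, absValue_ofPoint _ _ hi, valueFamily_apply a hi]
  let v : Γ(X, V) →+* boundedClasses 𝒰 k :=
    (ultraValue 𝒰 hev).codRestrict (boundedClasses 𝒰 k).toSubring fun a =>
      (ultraMk_mem_boundedClasses 𝒰).2
        ⟨_, (hlim a).eventually_le_const (lt_add_one (x.absValue V a))⟩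
  let l : Spec (CommRingCat.of (boundedClasses 𝒰 k)) ⟶ X :=
    Spec.map (CommRingCat.ofHom v) ≫ hV.fromSpec
  have hgen : boundedGeneric 𝒰 k ≫ l = ultraPoint 𝒰 hV hev := by
    rw [boundedGeneric, ← Category.assoc, ← Spec.map_comp]
    rfl
  have hl : l ≫ p = Spec.map (CommRingCat.ofHom (baseToBounded 𝒰 hφ)) :=
    comp_structure_of_generic hφ (hgen ▸ isUltraPoint_ultraPoint hV hev)
  have hlV : ⊤ ≤ l ⁻¹ᵁ V := top_le_preimage_fromSpec hV _
  have hsV : ⊤ ≤ (boundedSpecial 𝒰 k ≫ l) ⁻¹ᵁ V := top_le_preimage_comp _ _ hlV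
  refine ⟨l, hl, hgen, ?_⟩
  refine eq_of_absValue_eq hV (ofPoint_pt_mem.2 hsV) hxV fun a => ?_
  rw [absValue_ofPoint _ _ hsV]
  have h4 : valueAt l V hlV = CommRingCat.ofHom v := valueAt_fromSpec hV _ _
  have h5 : (valueAt (boundedSpecial 𝒰 k ≫ l) V hsV a : LimitField 𝒰 k) =
      toLimitField 𝒰 k (v a) := by
    rw [valueAt_boundedSpecial hlV hsV a, h4]
    rfl
  have h6 : (v a : Ultraproduct 𝒰 k) = ultraMk 𝒰 (valueFamily φ V a) := rfl
  rw [h5, norm_toLimitField, h6]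
  exact limNorm_eq 𝒰 (hlim a)

/-- Two limits of an ultrafilter come from two extensions of the same point with values in the
ultraproduct. These agree by the uniqueness part of the valuative criterion. -/
theorem t2Space [IsSeparated p] : T2Space (Analytification p) := by
  have hp : ValuativeCriterion.Uniqueness p := IsSeparated.valuativeCriterion p
  have : QuasiSeparatedSpace X :=
    (quasiSeparated_iff_quasiSeparatedSpace p).1 inferInstance
  refine t2_iff_ultrafilter.2 fun {x y} 𝒰 hx hy => ?_
  let φ (x : Analytification p) := x.fromSpecCompletedField
  have hφ (x : Analytification p) := x.norm_preimage_fromSpecCompletedField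
  have hid : (fun i => ofPoint (φ i) (hφ i)) = id := funext ofPoint_fromSpecCompletedField
  obtain ⟨_, ⟨U : X.Opens, hU, rfl⟩, hxU, -⟩ :=
    X.isBasis_affineOpens.exists_subset_of_mem_open (Set.mem_univ x.pt) isOpen_univ
  obtain ⟨_, ⟨V : X.Opens, hV, rfl⟩, hyV, -⟩ :=
    X.isBasis_affineOpens.exists_subset_of_mem_open (Set.mem_univ y.pt) isOpen_univ
  replace hU : IsAffineOpen U := hU
  replace hV : IsAffineOpen V := hV
  have key {O : X.Opens} {z : Analytification p} (hz : (𝒰 : Filter _) ≤ 𝓝 z) (hzO : z.pt ∈ O) :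
      ∀ᶠ i in 𝒰, ⊤ ≤ φ i ⁻¹ᵁ O := by
    filter_upwards [hz ((isOpen_setOf_pt_mem O).mem_nhds hzO)] with i hi
    rw [← ofPoint_pt_mem (h := hφ i)]
    have : i.pt ∈ O := hi
    rwa [ofPoint_fromSpecCompletedField]
  have hUe := key hx hxU
  have hVe := key hy hyV
  have hUV : ∀ᶠ i in 𝒰, ⊤ ≤ φ i ⁻¹ᵁ (U ⊓ V) := by
    filter_upwards [hUe, hVe] with i h h' using fun z hz => ⟨h hz, h' hz⟩
  -- A common affine chart inside of `U ⊓ V` shows that `U` and `V` define the same point with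
  -- values in the ultraproduct.
  obtain ⟨W, hW, hWUV, hWe⟩ := exists_isAffineOpen_eventually φ
    (QuasiSeparatedSpace.inter_isCompact (U : Set X) V U.2 hU.isCompact V.2 hV.isCompact) hUV
  obtain ⟨l, hl, hl1, hlx⟩ := exists_extension (𝒰 := 𝒰) hφ (by rw [hid]; exact hx) hU hxU hUe
  obtain ⟨m, hm, hm1, hmy⟩ := exists_extension (𝒰 := 𝒰) hφ (by rw [hid]; exact hy) hV hyV hVe
  rw [← ultraPoint_eq_of_le hW hU (hWUV.trans inf_le_left) hWe] at hl1
  rw [← ultraPoint_eq_of_le hW hV (hWUV.trans inf_le_right) hWe] at hm1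
  have hlm : l = m := congrArg CommSq.LiftStruct.l
    ((hp (ultraSquare hφ (isUltraPoint_ultraPoint hW hWe))).elim ⟨l, hl1, hl⟩ ⟨m, hm1, hm⟩)
  subst hlm
  exact hlx.symm.trans hmy

end Analytification

/-! ### Projective schemes are proper -/

attribute [local instance] MvPolynomial.gradedAlgebra in
theorem isProper_structureMorphism (K : Type u) [Field K] (N : ℕ) :
    IsProper (ProjSpace.structureMorphism K N) := by
  have : IsScalarTower K (MvPolynomial.homogeneousSubmodule (Fin (N + 1)) K 0)
      (MvPolynomial (Fin (N + 1)) K) := 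
    ⟨fun a b c => smul_mul_assoc a (b : MvPolynomial (Fin (N + 1)) K) c⟩
  have hfin : Algebra.FiniteType (MvPolynomial.homogeneousSubmodule (Fin (N + 1)) K 0)
      (MvPolynomial (Fin (N + 1)) K) :=
    Algebra.FiniteType.of_restrictScalars_finiteType K _ _
  have hsurj : Function.Surjective
      (algebraMap K (MvPolynomial.homogeneousSubmodule (Fin (N + 1)) K 0)) := by
    rintro ⟨a, ha⟩
    rw [MvPolynomial.homogeneousSubmodule_zero, Submodule.mem_one] at ha
    obtain ⟨b, rfl⟩ := ha
    exact ⟨b, rfl⟩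
  have : IsClosedImmersion (Spec.map (CommRingCat.ofHom
      (algebraMap K (MvPolynomial.homogeneousSubmodule (Fin (N + 1)) K 0)))) :=
    IsClosedImmersion.spec_of_surjective _ hsurj
  have h : IsProper (Proj.toSpecZero (MvPolynomial.homogeneousSubmodule (Fin (N + 1)) K)) :=
    inferInstance
  exact MorphismProperty.comp_mem _ _ _ h inferInstance

theorem IsProjective.isProper {K : Type u} [Field K] {X : Scheme.{u}}
    {p : X ⟶ Spec (CommRingCat.of K)} (h : IsProjective p) : IsProper p := by
  obtain ⟨N, i, hi, rfl⟩ := h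
  have := isProper_structureMorphism K N
  infer_instance

/-! ### Coordinates on a torsor -/

section Coordinates

variable {n : ℕ} {X S S' : Scheme.{u}}

/-- A morphism that lands in an open `U`, as a morphism to the scheme `U`. -/
def liftToOpen (φ : S ⟶ X) {U : X.Opens} (h : ⊤ ≤ φ ⁻¹ᵁ U) : S ⟶ (U : Scheme.{u}) :=
  IsOpenImmersion.lift U.ι φ (by
    rintro _ ⟨y, rfl⟩
    rw [Scheme.Opens.range_ι]
    exact h (show y ∈ ⊤ from trivial))

theorem liftToOpen_ι (φ : S ⟶ X) {U : X.Opens} (h : ⊤ ≤ φ ⁻¹ᵁ U) : liftToOpen φ h ≫ U.ι = φ :=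
  IsOpenImmersion.lift_fac _ _ _

theorem comp_liftToOpen (g : S' ⟶ S) (φ : S ⟶ X) {U : X.Opens} (h : ⊤ ≤ φ ⁻¹ᵁ U) :
    g ≫ liftToOpen φ h = liftToOpen (g ≫ φ) (top_le_preimage_comp g φ h) := by
  rw [← cancel_mono U.ι, Category.assoc, liftToOpen_ι, liftToOpen_ι]

variable (E : TorusTorsor n X) {U : X.Opens} (s : (U : Scheme.{u}) ⟶ E.total)
  (hs : s ≫ E.proj = U.ι)

/-- The coordinates `t`, with respect to a section `s` of the torsor over `U`, of a point `φ` of the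
torsor over `U`: they are determined by `φ = t · s`. -/
def TorusTorsor.coord (φ : S ⟶ E.total) (h : ⊤ ≤ (φ ≫ E.proj) ⁻¹ᵁ U) : TorusPoints n S :=
  (E.simply_transitive (liftToOpen (φ ≫ E.proj) h ≫ s) φ
    (by rw [Category.assoc, hs, liftToOpen_ι])).choose

theorem TorusTorsor.act_coord (φ : S ⟶ E.total) (h : ⊤ ≤ (φ ≫ E.proj) ⁻¹ᵁ U) :
    E.act (E.coord s hs φ h) (liftToOpen (φ ≫ E.proj) h ≫ s) = φ :=
  (E.simply_transitive (liftToOpen (φ ≫ E.proj) h ≫ s) φ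
    (by rw [Category.assoc, hs, liftToOpen_ι])).choose_spec.1

theorem TorusTorsor.eq_coord (φ : S ⟶ E.total) (h : ⊤ ≤ (φ ≫ E.proj) ⁻¹ᵁ U) (t : TorusPoints n S)
    (ht : E.act t (liftToOpen (φ ≫ E.proj) h ≫ s) = φ) : t = E.coord s hs φ h :=
  (E.simply_transitive (liftToOpen (φ ≫ E.proj) h ≫ s) φ
    (by rw [Category.assoc, hs, liftToOpen_ι])).choose_spec.2 t ht

theorem liftToOpen_congr {φ ψ : S ⟶ X} (e : φ = ψ) {U : X.Opens} (h : ⊤ ≤ φ ⁻¹ᵁ U)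
    (h' : ⊤ ≤ ψ ⁻¹ᵁ U) : liftToOpen φ h = liftToOpen ψ h' := by
  subst e; rfl

theorem TorusTorsor.coord_act (t : TorusPoints n S) (φ : S ⟶ E.total)
    (h : ⊤ ≤ (φ ≫ E.proj) ⁻¹ᵁ U) (h' : ⊤ ≤ (E.act t φ ≫ E.proj) ⁻¹ᵁ U) :
    E.coord s hs (E.act t φ) h' = t * E.coord s hs φ h := by
  refine (E.eq_coord s hs _ h' _ ?_).symm
  rw [E.mul_act, liftToOpen_congr (E.act_proj t φ) h' h, E.act_coord]

theorem TorusTorsor.coord_comp (g : S' ⟶ S) (φ : S ⟶ E.total)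
    (h : ⊤ ≤ (φ ≫ E.proj) ⁻¹ᵁ U) (h' : ⊤ ≤ ((g ≫ φ) ≫ E.proj) ⁻¹ᵁ U) :
    E.coord s hs (g ≫ φ) h' = (E.coord s hs φ h).pullback g := by
  refine (E.eq_coord s hs _ h' _ ?_).symm
  have : liftToOpen ((g ≫ φ) ≫ E.proj) h' = g ≫ liftToOpen (φ ≫ E.proj) h := by
    rw [comp_liftToOpen]
    exact liftToOpen_congr (Category.assoc _ _ _) _ _
  rw [this, Category.assoc, ← E.act_naturality, E.act_coord]

theorem top_le_preimage_ι (V : X.Opens) : ⊤ ≤ V.ι ⁻¹ᵁ V := fun y _ => y.2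

/-- The coordinates with respect to a section over `U`, as functions on the preimage of `U`. -/
def TorusTorsor.coordFun (i : Fin n) : Γ(E.total, E.proj ⁻¹ᵁ U) :=
  (E.proj ⁻¹ᵁ U).topIso.hom
    (E.coord s hs (E.proj ⁻¹ᵁ U).ι (top_le_preimage_ι (E.proj ⁻¹ᵁ U)) i).val

theorem topIso_hom_valueAt {B : CommRingCat.{u}} (φ : Spec B ⟶ X) {V : X.Opens}
    (h : ⊤ ≤ φ ⁻¹ᵁ V) :
    V.topIso.hom ≫ valueAt φ V h = (liftToOpen φ h).appTop ≫ (Scheme.ΓSpecIso B).hom := by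
  have h1 : V.ι.appLE V ⊤ (top_le_preimage_ι V) ≫ (liftToOpen φ h).appLE ⊤ ⊤ le_top =
      φ.appLE V ⊤ h := by
    have e := liftToOpen_ι φ h
    refine (Scheme.Hom.appLE_comp_appLE _ _ _ _ _ _ _).trans ?_
    congr 1
  have h2 : V.topIso.hom ≫ V.ι.appLE V ⊤ (top_le_preimage_ι V) = 𝟙 _ := by
    rw [Scheme.Opens.ι_appLE, Scheme.Opens.topIso_hom]
    exact (X.presheaf.map_comp _ _).symm.trans (X.presheaf.map_id _)
  have h3 : (liftToOpen φ h).appLE ⊤ ⊤ le_top = (liftToOpen φ h).appTop := by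
    rw [Scheme.Hom.appTop, Scheme.Hom.app_eq_appLE]
    rfl
  rw [valueAt, ← h1, h3, ← Category.assoc, ← Category.assoc]
  refine congrArg (· ≫ _) ?_
  rw [h2, Category.id_comp]

/-- The `i`-th coordinate of a `B`-valued point of the torus, as a unit of `B`. -/
def coordValue {B : CommRingCat.{u}} (t : TorusPoints n (Spec B)) (i : Fin n) : Bˣ :=
  Units.map ((Scheme.ΓSpecIso B).hom.hom : Γ(Spec B, ⊤) →* B) (t i)

theorem coordValue_mul {B : CommRingCat.{u}} (t t' : TorusPoints n (Spec B)) (i : Fin n) :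
    coordValue (t * t') i = coordValue t i * coordValue t' i :=
  map_mul _ _ _

theorem TorusTorsor.valueAt_coordFun {B : CommRingCat.{u}} (φ : Spec B ⟶ E.total)
    (h : ⊤ ≤ (φ ≫ E.proj) ⁻¹ᵁ U) (i : Fin n) :
    valueAt φ (E.proj ⁻¹ᵁ U) h (E.coordFun s hs i) = coordValue (E.coord s hs φ h) i := by
  have h0 : ⊤ ≤ φ ⁻¹ᵁ (E.proj ⁻¹ᵁ U) := h
  have e : liftToOpen φ h0 ≫ (E.proj ⁻¹ᵁ U).ι = φ := liftToOpen_ι _ _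
  have key : ∀ (ψ : Spec B ⟶ E.total) (h' : ⊤ ≤ (ψ ≫ E.proj) ⁻¹ᵁ U), ψ = φ →
      E.coord s hs ψ h' = E.coord s hs φ h := by rintro _ _ rfl; rfl
  have h2 : (E.coord s hs (E.proj ⁻¹ᵁ U).ι (top_le_preimage_ι (E.proj ⁻¹ᵁ U))).pullback
      (liftToOpen φ h0) = E.coord s hs φ h :=
    (E.coord_comp s hs (liftToOpen φ h0) (E.proj ⁻¹ᵁ U).ι
      (top_le_preimage_ι (E.proj ⁻¹ᵁ U)) (h.trans_eq (by rw [e]))).symm.trans (key _ _ e)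
  rw [← h2]
  exact congrArg (fun g => g.hom (E.coord s hs (E.proj ⁻¹ᵁ U).ι
    (top_le_preimage_ι (E.proj ⁻¹ᵁ U)) i).val) (topIso_hom_valueAt φ h0)

end Coordinates

/-! ### Invariant functions are bounded -/

section Bounded

open Filter Topology Analytification

namespace Analytification

variable {K : Type u} [NormedField K] {X Y : Scheme.{u}} {p : X ⟶ Spec (CommRingCat.of K)}
  {q : Y ⟶ Spec (CommRingCat.of K)}

theorem norm_completedFieldMap (g : X ⟶ Y) (hg : g ≫ q = p) (x : Analytification p)
    (a : (x.map g hg).CompletedField) : ‖x.completedFieldMap g hg a‖ = ‖a‖ := by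
  have h : Isometry (((WithAbs.equiv x.abv).symm.toRingHom.comp (g.residueFieldMap x.pt).hom).comp
      (WithAbs.equiv (x.map g hg).abv).toRingHom) :=
    AddMonoidHomClass.isometry_of_norm _ fun _ => rfl
  exact (h.completion_map.norm_map_of_map_zero (map_zero (x.completedFieldMap g hg))) a

/-- An element of `K` of absolute value greater than one scales every positive real number into a
fixed compact interval. -/
theorem exists_scaling (x : Analytification p) {c : K} (hc : 1 < ‖c‖) {r : ℝ} (hr : 0 < r) :
    ∃ t : x.CompletedFieldˣ, 1 ≤ ‖(t : x.CompletedField)‖ * r ∧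
      ‖(t : x.CompletedField)‖ * r ≤ ‖c‖ := by
  obtain ⟨m, hm1, hm2⟩ := exists_mem_Ico_zpow hr hc
  have hc0 : c ≠ 0 := norm_pos_iff.1 (one_pos.trans hc)
  have hpos : 0 < ‖c‖ := one_pos.trans hc
  let j : K →+* x.CompletedField := x.toCompletedField.comp (baseToResidueField p x.pt)
  have hj (a : K) : ‖j a‖ = ‖a‖ := (x.norm_toCompletedField _).trans (x.abv_base a)
  refine ⟨Units.map (j : K →* x.CompletedField) (Units.mk0 c hc0 ^ (-m)), ?_⟩
  have : ‖((Units.map (j : K →* x.CompletedField) (Units.mk0 c hc0 ^ (-m)) :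
      x.CompletedFieldˣ) : x.CompletedField)‖ = (‖c‖ ^ m)⁻¹ := by
    rw [Units.coe_map]
    refine (hj _).trans ?_
    rw [Units.val_zpow_eq_zpow_val, Units.val_mk0, norm_zpow, zpow_neg]
  rw [this]
  have hpm := zpow_pos hpos m
  constructor
  · rw [inv_mul_eq_div, one_le_div hpm]; exact hm1
  · rw [inv_mul_eq_div, div_le_iff₀ hpm, ← zpow_one_add₀ hpos.ne', add_comm]; exact hm2.le

end Analytification

variable {K : Type u} {X : Scheme.{u}} {n : ℕ}

/-- The norm of the `i`-th coordinate of a point of the torus over a normed field. -/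
def normCoord {L : Type u} [NormedField L] (t : TorusPoints n (Spec (CommRingCat.of L)))
    (i : Fin n) : ℝ :=
  ‖((coordValue t i : Lˣ) : L)‖

theorem normCoord_mul {L : Type u} [NormedField L]
    (t t' : TorusPoints n (Spec (CommRingCat.of L))) (i : Fin n) :
    normCoord (t * t') i = normCoord t i * normCoord t' i := by
  rw [normCoord, coordValue_mul, Units.val_mul, norm_mul, normCoord, normCoord]

theorem normCoord_pos {L : Type u} [NormedField L] (t : TorusPoints n (Spec (CommRingCat.of L)))
    (i : Fin n) : 0 < normCoord t i :=
  norm_pos_iff.2 (coordValue t i).ne_zero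

/-- A point of the torus over `ℋ(x)` as a point of the torus over `ℋ(e)`, for `e` over `x`. -/
def TorusTorsor.liftTorusPoint [NormedField K] (E : TorusTorsor n X)
    (p : X ⟶ Spec (CommRingCat.of K))
    (e : Analytification (E.proj ≫ p)) (t : Fin n → ((e.map E.proj rfl).CompletedField)ˣ) :
    TorusPoints n (Spec (CommRingCat.of e.CompletedField)) :=
  fun i => Units.map
    (((Scheme.ΓSpecIso (CommRingCat.of e.CompletedField)).inv.hom.comp
      (e.completedFieldMap E.proj rfl) :
      (e.map E.proj rfl).CompletedField →+* Γ(Spec (CommRingCat.of e.CompletedField), ⊤)) :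
      (e.map E.proj rfl).CompletedField →* _) (t i)

theorem TorusTorsor.normCoord_liftTorusPoint [NormedField K] (E : TorusTorsor n X)
    (p : X ⟶ Spec (CommRingCat.of K)) (e : Analytification (E.proj ≫ p))
    (t : Fin n → ((e.map E.proj rfl).CompletedField)ˣ) (i : Fin n) :
    normCoord (E.liftTorusPoint p e t) i = ‖(t i : (e.map E.proj rfl).CompletedField)‖ := by
  rw [← norm_completedFieldMap E.proj rfl e (t i)]
  refine congrArg norm ?_
  exact congrArg (fun g => g.hom (e.completedFieldMap E.proj rfl (t i)))
    (Scheme.ΓSpecIso (CommRingCat.of e.CompletedField)).inv_hom_id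

theorem TorusTorsor.normCoord_coord_act [NormedField K] (E : TorusTorsor n X)
    (p : X ⟶ Spec (CommRingCat.of K)) {U : X.Opens} (s : (U : Scheme.{u}) ⟶ E.total)
    (hs : s ≫ E.proj = U.ι) (e : Analytification (E.proj ≫ p))
    (t : Fin n → ((e.map E.proj rfl).CompletedField)ˣ)
    (h : ⊤ ≤ (e.fromSpecCompletedField ≫ E.proj) ⁻¹ᵁ U)
    (h' : ⊤ ≤ (E.act (E.liftTorusPoint p e t) e.fromSpecCompletedField ≫ E.proj) ⁻¹ᵁ U)
    (i : Fin n) :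
    normCoord (E.coord s hs (E.act (E.liftTorusPoint p e t) e.fromSpecCompletedField) h') i =
      ‖(t i : (e.map E.proj rfl).CompletedField)‖ *
        normCoord (E.coord s hs e.fromSpecCompletedField h) i := by
  rw [E.coord_act s hs _ _ h, normCoord_mul, E.normCoord_liftTorusPoint]

theorem TorusTorsor.norm_preimage_act [NormedField K] (E : TorusTorsor n X)
    (p : X ⟶ Spec (CommRingCat.of K)) {L : Type u} [NormedField L]
    (t : TorusPoints n (Spec (CommRingCat.of L))) {φ : Spec (CommRingCat.of L) ⟶ E.total}
    (h : ∀ a : K, ‖(Spec.preimage (φ ≫ E.proj ≫ p)).hom a‖ = ‖a‖) (a : K) :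
    ‖(Spec.preimage (E.act t φ ≫ E.proj ≫ p)).hom a‖ = ‖a‖ := by
  rw [← Category.assoc, E.act_proj, Category.assoc]
  exact h a

theorem specMap_liftToOpen {B C : CommRingCat.{u}} {U : X.Opens} (hU : IsAffineOpen U)
    (Ψ : Γ(X, U) ⟶ B) (j : B ⟶ C) (φ : Spec C ⟶ X) (h : ⊤ ≤ φ ⁻¹ᵁ U)
    (e : Ψ ≫ j = valueAt φ U h) :
    Spec.map j ≫ liftToOpen (Spec.map Ψ ≫ hU.fromSpec) (top_le_preimage_fromSpec hU Ψ) =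
      liftToOpen φ h := by
  rw [← cancel_mono U.ι, Category.assoc, liftToOpen_ι, liftToOpen_ι, ← Category.assoc,
    ← Spec.map_comp, e, specMap_valueAt_fromSpec]

/-- Points of the torsor with bounded coordinates over a convergent family of points of the base
have a limit. -/
theorem TorusTorsor.exists_tendsto [NormedField K] (E : TorusTorsor n X)
    (p : X ⟶ Spec (CommRingCat.of K)) {ι : Type u} (𝒰 : Ultrafilter ι) {k : ι → Type u}
    [∀ i, NormedField (k i)] (φ : ∀ i, Spec (CommRingCat.of (k i)) ⟶ E.total)
    (hφ : ∀ i, ∀ a : K, ‖(Spec.preimage (φ i ≫ E.proj ≫ p)).hom a‖ = ‖a‖)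
    {U : X.Opens} (hU : IsAffineOpen U) (s : (U : Scheme.{u}) ⟶ E.total) (hs : s ≫ E.proj = U.ι)
    (hφU : ∀ i, ⊤ ≤ (φ i ≫ E.proj) ⁻¹ᵁ U)
    (hbase : ∀ a, ∃ C, ∀ᶠ i in 𝒰, ‖(valueAt (φ i ≫ E.proj) U (hφU i) a : k i)‖ ≤ C)
    (C : ℝ) (hcoord : ∀ i j, normCoord (E.coord s hs (φ i) (hφU i)) j ≤ C)
    (hcoord' : ∀ i j, 1 ≤ normCoord (E.coord s hs (φ i) (hφU i)) j) :
    ∃ z : Analytification (E.proj ≫ p), Tendsto (fun i => ofPoint (φ i) (hφ i)) 𝒰 (𝓝 z) := by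
  -- The coordinates and the base points define a point of the torsor over the ring of bounded
  -- families, which restricts to the given points.
  let Ψ₀ : Γ(X, U) →+* ∀ i, k i := RingHom.pi fun i => (valueAt (φ i ≫ E.proj) U (hφU i)).hom
  let Ψ : Γ(X, U) →+* boundedFamilies 𝒰 k :=
    Ψ₀.codRestrict _ fun a => (mem_boundedFamilies 𝒰).2 (hbase a)
  let w (j : Fin n) : (boundedFamilies 𝒰 k)ˣ :=
    { val := ⟨fun i => ((coordValue (E.coord s hs (φ i) (hφU i)) j : (k i)ˣ) : k i),
        (mem_boundedFamilies 𝒰).2 ⟨C, Eventually.of_forall fun i => hcoord i j⟩⟩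
      inv := ⟨fun i => (((coordValue (E.coord s hs (φ i) (hφU i)) j)⁻¹ : (k i)ˣ) : k i),
        (mem_boundedFamilies 𝒰).2 ⟨1, Eventually.of_forall fun i => by
          rw [Units.val_inv_eq_inv_val, norm_inv]
          exact inv_le_one_of_one_le₀ (hcoord' i j)⟩⟩
      val_inv := Subtype.ext (funext fun i => Units.mul_inv _)
      inv_val := Subtype.ext (funext fun i => Units.inv_mul _) }
  let W : TorusPoints n (Spec (CommRingCat.of (boundedFamilies 𝒰 k))) := fun j =>
    Units.map ((Scheme.ΓSpecIso (CommRingCat.of (boundedFamilies 𝒰 k))).inv.hom :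
      boundedFamilies 𝒰 k →* _) (w j)
  let g : Spec (CommRingCat.of (boundedFamilies 𝒰 k)) ⟶ E.total :=
    E.act W (liftToOpen (Spec.map (CommRingCat.ofHom Ψ) ≫ hU.fromSpec)
      (top_le_preimage_fromSpec hU _) ≫ s)
  let pr (i : ι) : boundedFamilies 𝒰 k →+* k i :=
    (Pi.evalRingHom k i).comp (boundedFamilies 𝒰 k).subtype
  have hg (i : ι) : Spec.map (CommRingCat.ofHom (pr i)) ≫ g = φ i := by
    have h1 : W.pullback (Spec.map (CommRingCat.ofHom (pr i))) =
        E.coord s hs (φ i) (hφU i) := by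
      funext j
      refine Units.ext ?_
      have hnat := Scheme.ΓSpecIso_inv_naturality (CommRingCat.ofHom (pr i))
      have h2 := congrArg (fun g => g.hom ((w j : boundedFamilies 𝒰 k))) hnat
      refine h2.symm.trans ?_
      exact congrArg (fun g => g.hom (E.coord s hs (φ i) (hφU i) j).val)
        (Scheme.ΓSpecIso (CommRingCat.of (k i))).hom_inv_id
    have h2 := specMap_liftToOpen hU (CommRingCat.ofHom Ψ) (CommRingCat.ofHom (pr i))
      (φ i ≫ E.proj) (hφU i) rfl
    rw [E.act_naturality, h1, ← Category.assoc, h2, E.act_coord]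
  have H : IsUltraPoint 𝒰 (boundedGeneric 𝒰 k ≫ Spec.map (CommRingCat.ofHom (boundedMk 𝒰 k)) ≫ g)
      φ := by
    have h1 := isUltraPoint_ultraPoint (𝒰 := 𝒰) (φ := fun i => Spec.map (CommRingCat.ofHom (pr i)))
      (isAffineOpen_top _) (Eventually.of_forall fun i => le_top)
    rw [h1.eq_specMap (boundedFamilies 𝒰 k).subtype fun i => rfl] at h1
    have h2 := h1.comp g
    simp only [hg] at h2
    convert h2 using 1
    rw [← Category.assoc, boundedGeneric, ← Spec.map_comp]
    rfl
  exact ⟨_, tendsto_ofPoint hφ H (norm_boundedSpecial hφ (comp_structure_of_generic hφ H))⟩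

/-- Locally on the base, a continuous function which is invariant under the torus is bounded. -/
theorem TorusTorsor.exists_local_bound [NontriviallyNormedField K] (E : TorusTorsor n X)
    (p : X ⟶ Spec (CommRingCat.of K)) {D : Analytification (E.proj ≫ p) → ℝ} (hD : Continuous D)
    (hinv : ∀ e t, D (E.translate p e t) = D e) (x : Analytification p) :
    ∃ N ∈ 𝓝 x, ∃ C : ℝ, ∀ e : Analytification (E.proj ≫ p), e.map E.proj rfl ∈ N → |D e| ≤ C := by
  obtain ⟨U₀, hxU₀, s₀, hs₀⟩ := E.locally_trivial x.pt
  obtain ⟨_, ⟨U : X.Opens, hU, rfl⟩, hxU, hUU₀⟩ :=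
    X.isBasis_affineOpens.exists_subset_of_mem_open hxU₀ U₀.2
  replace hU : IsAffineOpen U := hU
  replace hUU₀ : U ≤ U₀ := hUU₀
  let s : (U : Scheme.{u}) ⟶ E.total := X.homOfLE hUU₀ ≫ s₀
  have hs : s ≫ E.proj = U.ι := by rw [Category.assoc, hs₀, X.homOfLE_ι]
  let ι := {e : Analytification (E.proj ≫ p) // (e.map E.proj rfl).pt ∈ U}
  let ℱ : Filter ι := comap (fun e => e.1.map E.proj rfl) (𝓝 x) ⊓ comap (fun e => |D e.1|) atTop
  -- If `D` is unbounded near the fibre over `x`, then `ℱ` is a proper filter.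
  rcases ℱ.eq_or_neBot with hℱ | hℱ
  · obtain ⟨s, ⟨N, hN, hNs⟩, t, ⟨A, hA, hAt⟩, hst⟩ := Filter.inf_eq_bot_iff.1 hℱ
    obtain ⟨C, hC⟩ := mem_atTop_sets.1 hA
    refine ⟨N ∩ {y | y.pt ∈ U}, inter_mem hN ((isOpen_setOf_pt_mem U).mem_nhds hxU), C,
      fun e he => le_of_not_gt fun hlt => ?_⟩
    have : (⟨e, he.2⟩ : ι) ∈ s ∩ t := ⟨hNs he.1, hAt (hC _ hlt.le)⟩
    rwa [hst] at this
  · exfalso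
    let 𝒰 := Ultrafilter.of ℱ
    have h𝒰 : (𝒰 : Filter ι) ≤ ℱ := Ultrafilter.of_le ℱ
    have hbase : Tendsto (fun e : ι => e.1.map E.proj rfl) 𝒰 (𝓝 x) :=
      tendsto_comap.mono_left (h𝒰.trans inf_le_left)
    have hDtop : Tendsto (fun e : ι => |D e.1|) 𝒰 atTop :=
      tendsto_comap.mono_left (h𝒰.trans inf_le_right)
    have hξU (e : ι) : ⊤ ≤ (e.1.fromSpecCompletedField ≫ E.proj) ⁻¹ᵁ U := by
      have := e.2
      rw [← ofPoint_fromSpecCompletedField e.1, map_ofPoint, ofPoint_pt_mem] at this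
      exact this
    obtain ⟨c, hc⟩ := NormedField.exists_one_lt_norm K
    -- Scale the coordinates into a compact interval.
    have hscale (e : ι) (j : Fin n) := exists_scaling (e.1.map E.proj rfl) hc
      (normCoord_pos (E.coord s hs e.1.fromSpecCompletedField (hξU e)) j)
    choose t ht1 ht2 using hscale
    let φ (e : ι) := E.act (E.liftTorusPoint p e.1 (t e)) e.1.fromSpecCompletedField
    have hφ (e : ι) := E.norm_preimage_act p (E.liftTorusPoint p e.1 (t e))
      e.1.norm_preimage_fromSpecCompletedField
    have hφU (e : ι) : ⊤ ≤ (φ e ≫ E.proj) ⁻¹ᵁ U := by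
      rw [E.act_proj]; exact hξU e
    have hcoord (e : ι) (j : Fin n) : normCoord (E.coord s hs (φ e) (hφU e)) j =
        ‖(t e j : (e.1.map E.proj rfl).CompletedField)‖ *
          normCoord (E.coord s hs e.1.fromSpecCompletedField (hξU e)) j := by
      exact E.normCoord_coord_act p s hs e.1 (t e) (hξU e) (hφU e) j
    obtain ⟨z, hz⟩ := E.exists_tendsto p 𝒰 φ hφ hU s hs hφU
      (fun a => by
        have h1 := ((continuousAt_absValue a hxU).tendsto.comp hbase).eventually_le_const
          (lt_add_one (x.absValue U a))
        refine ⟨_, h1.mono fun e he => le_trans (le_of_eq ?_) he⟩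
        have h2 : ofPoint (p := p) (φ e ≫ E.proj) (norm_preimage_comp (hφ e) rfl) =
            e.1.map E.proj rfl := by
          rw [← map_ofPoint (φ e) (hφ e) E.proj rfl]
          conv_rhs => rw [← ofPoint_fromSpecCompletedField e.1]
          rw [map_ofPoint, map_ofPoint]
          exact ofPoint_congr (E.act_proj _ _) _ _
        rw [Function.comp_apply, ← h2, absValue_ofPoint _ _ (hφU e)])
      ‖c‖ (fun e j => by rw [hcoord]; exact ht2 e j)
      (fun e j => by rw [hcoord]; exact ht1 e j)
    have hDz := (hD.tendsto z).comp hz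
    have hDe : (D ∘ fun e : ι => ofPoint (φ e) (hφ e)) = fun e => D e.1 :=
      funext fun e => hinv e.1 (t e)
    rw [hDe] at hDz
    exact not_tendsto_nhds_of_tendsto_atTop hDtop _ hDz.abs

theorem TorusTorsor.exists_bound [NontriviallyNormedField K] (E : TorusTorsor n X)
    (p : X ⟶ Spec (CommRingCat.of K)) [CompactSpace (Analytification p)]
    {D : Analytification (E.proj ≫ p) → ℝ} (hD : Continuous D)
    (hinv : ∀ e t, D (E.translate p e t) = D e) : ∃ C : ℝ, ∀ e, |D e| ≤ C := by
  have := isCompact_univ.induction_on (X := Analytification p)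
    (p := fun N => ∃ C : ℝ, ∀ e : Analytification (E.proj ≫ p), e.map E.proj rfl ∈ N → |D e| ≤ C)
    ⟨0, fun e he => he.elim⟩ (fun s t hst ⟨C, hC⟩ => ⟨C, fun e he => hC e (hst he)⟩)
    (fun s t ⟨C, hC⟩ ⟨C', hC'⟩ => ⟨max C C', fun e he => he.elim
      (fun h => (hC e h).trans (le_max_left _ _)) fun h => (hC' e h).trans (le_max_right _ _)⟩)
    (fun x _ => by
      obtain ⟨N, hN, hC⟩ := E.exists_local_bound p hD hinv x
      exact ⟨N, mem_nhdsWithin_of_mem_nhds hN, hC⟩)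
  obtain ⟨C, hC⟩ := this
  exact ⟨C, fun e => hC e (Set.mem_univ _)⟩

end Bounded

/-! ### Homogeneous functions and their pullbacks -/

section Homogeneous

open Filter Topology Analytification

variable {K : Type u} [NormedField K] {X : Scheme.{u}} {n : ℕ}

/-- Homogeneity of a function on the analytification of a torsor, tested on points with values in
all normed extension fields. It implies homogeneity, and is inherited by pullbacks under
equivariant morphisms without any assumption on the map of the bases. -/
def TorusTorsor.IsStronglyHomogeneous (E : TorusTorsor n X) (p : X ⟶ Spec (CommRingCat.of K))
    (α : Fin n → ℝ) (G : Analytification (E.proj ≫ p) → ℝ) : Prop :=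
  ∀ (L : Type u) [NormedField L] (φ : Spec (CommRingCat.of L) ⟶ E.total)
    (h : ∀ a : K, ‖(Spec.preimage (φ ≫ E.proj ≫ p)).hom a‖ = ‖a‖)
    (t : TorusPoints n (Spec (CommRingCat.of L))),
    G (ofPoint (E.act t φ) (E.norm_preimage_act p t h)) =
      G (ofPoint φ h) + ∑ i, α i * Real.log (normCoord t i)

theorem TorusTorsor.IsStronglyHomogeneous.isHomogeneous {E : TorusTorsor n X}
    {p : X ⟶ Spec (CommRingCat.of K)} {α : Fin n → ℝ} {G : Analytification (E.proj ≫ p) → ℝ}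
    (hG : E.IsStronglyHomogeneous p α G) : E.IsHomogeneous p α G := by
  intro e t
  have h := hG _ e.fromSpecCompletedField e.norm_preimage_fromSpecCompletedField
    (E.liftTorusPoint p e t)
  rw [ofPoint_fromSpecCompletedField] at h
  simp only [E.normCoord_liftTorusPoint] at h
  exact h

theorem TorusTorsor.IsStronglyHomogeneous.translate_eq {E : TorusTorsor n X}
    {p : X ⟶ Spec (CommRingCat.of K)} {G : Analytification (E.proj ≫ p) → ℝ}
    (hG : E.IsStronglyHomogeneous p 0 G) (e : Analytification (E.proj ≫ p))
    (t : Fin n → ((e.map E.proj rfl).CompletedField)ˣ) : G (E.translate p e t) = G e := by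
  have := hG.isHomogeneous e t
  simpa using this

theorem log_normCoord_torusEnd {L : Type u} [NormedField L] (A : Matrix (Fin n) (Fin n) ℤ)
    (t : TorusPoints n (Spec (CommRingCat.of L))) (i : Fin n) :
    Real.log (normCoord (torusEnd A t) i) = ∑ j, (A i j : ℝ) * Real.log (normCoord t j) := by
  have : normCoord (torusEnd A t) i = ∏ j, normCoord t j ^ A i j := by
    have h : coordValue (torusEnd A t) i = ∏ j, coordValue t j ^ A i j := by
      simp only [coordValue, torusEnd, map_prod, map_zpow]
    rw [normCoord, h, Units.coe_prod, norm_prod]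
    refine Finset.prod_congr rfl fun j _ => ?_
    rw [Units.val_zpow_eq_zpow_val, norm_zpow, normCoord]
  rw [this, Real.log_prod fun j _ => (zpow_pos (normCoord_pos t j) _).ne']
  simp only [Real.log_zpow]

/-- Pullback under a morphism which is equivariant along the endomorphism `A` of the torus acts on
weights by `Aᵀ`. -/
theorem TorusTorsor.IsStronglyHomogeneous.comp_map {E : TorusTorsor n X}
    {p : X ⟶ Spec (CommRingCat.of K)} {α : Fin n → ℝ} {G : Analytification (E.proj ≫ p) → ℝ}
    (hG : E.IsStronglyHomogeneous p α G) {F : E.total ⟶ E.total}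
    (hF : F ≫ E.proj ≫ p = E.proj ≫ p) {A : Matrix (Fin n) (Fin n) ℤ} (hA : E.IsEquivariant F A) :
    E.IsStronglyHomogeneous p ((A.transpose.map (Int.cast : ℤ → ℝ)).mulVec α)
      fun e => G (e.map F hF) := by
  intro L _ φ h t
  simp only [map_ofPoint]
  have h1 := hG L (φ ≫ F) (norm_preimage_comp h hF) (torusEnd A t)
  rw [ofPoint_congr (hA t φ) _ (E.norm_preimage_act p _ (norm_preimage_comp h hF)), h1]
  congr 1
  simp only [log_normCoord_torusEnd, Matrix.mulVec, dotProduct, Matrix.map_apply,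
    Matrix.transpose_apply, Finset.mul_sum, Finset.sum_mul]
  rw [Finset.sum_comm]
  refine Finset.sum_congr rfl fun j _ => Finset.sum_congr rfl fun i _ => ?_
  ring

theorem TorusTorsor.IsStronglyHomogeneous.smul {E : TorusTorsor n X}
    {p : X ⟶ Spec (CommRingCat.of K)} {α : Fin n → ℝ} {G : Analytification (E.proj ≫ p) → ℝ}
    (hG : E.IsStronglyHomogeneous p α G) (c : ℝ) :
    E.IsStronglyHomogeneous p (c • α) fun e => c * G e := by
  intro L _ φ h t
  simp only [hG L φ h t, mul_add, Finset.mul_sum, Pi.smul_apply, smul_eq_mul, mul_assoc]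

theorem TorusTorsor.IsStronglyHomogeneous.sub {E : TorusTorsor n X}
    {p : X ⟶ Spec (CommRingCat.of K)} {α β : Fin n → ℝ} {G G' : Analytification (E.proj ≫ p) → ℝ}
    (hG : E.IsStronglyHomogeneous p α G) (hG' : E.IsStronglyHomogeneous p β G') :
    E.IsStronglyHomogeneous p (α - β) fun e => G e - G' e := by
  intro L _ φ h t
  simp only [hG L φ h t, hG' L φ h t, Pi.sub_apply, sub_mul, Finset.sum_sub_distrib]
  ring

/-! ### Existence of a continuous homogeneous function -/

/-- The homogeneous function `log |α(t)|` over `U`, where `t` are the coordinates with respect to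
a section over `U`. -/
def TorusTorsor.localLog (E : TorusTorsor n X) (p : X ⟶ Spec (CommRingCat.of K)) (α : Fin n → ℝ)
    {U : X.Opens} (s : (U : Scheme.{u}) ⟶ E.total) (hs : s ≫ E.proj = U.ι)
    (e : Analytification (E.proj ≫ p)) : ℝ :=
  ∑ i, α i * Real.log (e.absValue (E.proj ⁻¹ᵁ U) (E.coordFun s hs i))

theorem TorusTorsor.absValue_coordFun (E : TorusTorsor n X) (p : X ⟶ Spec (CommRingCat.of K))
    {U : X.Opens} (s : (U : Scheme.{u}) ⟶ E.total) (hs : s ≫ E.proj = U.ι)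
    {L : Type u} [NormedField L] (φ : Spec (CommRingCat.of L) ⟶ E.total)
    (h : ∀ a : K, ‖(Spec.preimage (φ ≫ E.proj ≫ p)).hom a‖ = ‖a‖)
    (hU : ⊤ ≤ (φ ≫ E.proj) ⁻¹ᵁ U) (i : Fin n) :
    (ofPoint φ h).absValue (E.proj ⁻¹ᵁ U) (E.coordFun s hs i) =
      normCoord (E.coord s hs φ hU) i := by
  rw [absValue_ofPoint (V := E.proj ⁻¹ᵁ U) φ h hU, E.valueAt_coordFun s hs φ hU, normCoord]

theorem TorusTorsor.localLog_act (E : TorusTorsor n X) (p : X ⟶ Spec (CommRingCat.of K))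
    (α : Fin n → ℝ) {U : X.Opens} (s : (U : Scheme.{u}) ⟶ E.total) (hs : s ≫ E.proj = U.ι)
    {L : Type u} [NormedField L] (φ : Spec (CommRingCat.of L) ⟶ E.total)
    (h : ∀ a : K, ‖(Spec.preimage (φ ≫ E.proj ≫ p)).hom a‖ = ‖a‖)
    (hU : ⊤ ≤ (φ ≫ E.proj) ⁻¹ᵁ U) (t : TorusPoints n (Spec (CommRingCat.of L))) :
    E.localLog p α s hs (ofPoint (E.act t φ) (E.norm_preimage_act p t h)) =
      E.localLog p α s hs (ofPoint φ h) + ∑ i, α i * Real.log (normCoord t i) := by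
  have hU' : ⊤ ≤ (E.act t φ ≫ E.proj) ⁻¹ᵁ U := by rw [E.act_proj]; exact hU
  rw [localLog, localLog, ← Finset.sum_add_distrib]
  refine Finset.sum_congr rfl fun i _ => ?_
  rw [E.absValue_coordFun p s hs _ _ hU', E.absValue_coordFun p s hs _ _ hU,
    E.coord_act s hs t φ hU hU', normCoord_mul,
    Real.log_mul (normCoord_pos _ _).ne' (normCoord_pos _ _).ne']
  ring

theorem TorusTorsor.continuousAt_localLog (E : TorusTorsor n X) (p : X ⟶ Spec (CommRingCat.of K))
    (α : Fin n → ℝ) {U : X.Opens} (s : (U : Scheme.{u}) ⟶ E.total) (hs : s ≫ E.proj = U.ι)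
    {e : Analytification (E.proj ≫ p)} (he : (e.map E.proj rfl).pt ∈ U) :
    ContinuousAt (E.localLog p α s hs) e := by
  have he' : e.pt ∈ E.proj ⁻¹ᵁ U := he
  have hU : ⊤ ≤ (e.fromSpecCompletedField ≫ E.proj) ⁻¹ᵁ U := by
    rw [← ofPoint_fromSpecCompletedField e, map_ofPoint, ofPoint_pt_mem] at he
    exact he
  unfold localLog
  refine tendsto_finsetSum _ fun i _ => ContinuousAt.mul continuousAt_const
    (ContinuousAt.log (continuousAt_absValue _ he') ?_)
  have := E.absValue_coordFun p s hs e.fromSpecCompletedField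
    e.norm_preimage_fromSpecCompletedField hU i
  rw [ofPoint_fromSpecCompletedField] at this
  rw [this]
  exact (normCoord_pos _ _).ne'

/-- Local homogeneous functions are glued by a partition of unity on the compact Hausdorff base. -/
theorem TorusTorsor.exists_continuous_isStronglyHomogeneous (E : TorusTorsor n X)
    (p : X ⟶ Spec (CommRingCat.of K)) [CompactSpace (Analytification p)]
    [T2Space (Analytification p)] (α : Fin n → ℝ) :
    ∃ G : Analytification (E.proj ≫ p) → ℝ, Continuous G ∧ E.IsStronglyHomogeneous p α G := by
  choose U hxU s hs using E.locally_trivial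
  obtain ⟨T, hT⟩ := isCompact_univ.elim_finite_subcover
    (fun x : X => {y : Analytification p | y.pt ∈ U x}) (fun x => isOpen_setOf_pt_mem (U x))
    fun y _ => Set.mem_iUnion.2 ⟨y.pt, hxU y.pt⟩
  obtain ⟨ρ, hρ⟩ := PartitionOfUnity.exists_isSubordinate (X := Analytification p) isClosed_univ
    (fun x : T => {y : Analytification p | y.pt ∈ U x}) (fun x => isOpen_setOf_pt_mem (U x))
    (by simpa [Set.iUnion_subtype] using hT)
  have hsum (y : Analytification p) : ∑ x : T, ρ x y = 1 := by
    rw [← finsum_eq_sum_of_fintype]; exact ρ.sum_eq_one (Set.mem_univ y)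
  refine ⟨fun e => ∑ x : T, ρ x (e.map E.proj rfl) * E.localLog p α (s x) (hs x) e, ?_, ?_⟩
  · refine continuous_finsetSum _ fun x _ => continuous_of_tsupport fun e he => ?_
    have he' : e.map E.proj rfl ∈ tsupport (ρ x) := by
      have h1 : Function.support (fun e : Analytification (E.proj ≫ p) =>
          ρ x (e.map E.proj rfl) * E.localLog p α (s x) (hs x) e) ⊆
          (fun e => e.map E.proj rfl) ⁻¹' tsupport (ρ x) := fun e he =>
        subset_tsupport _ (left_ne_zero_of_mul he)
      exact closure_minimal h1 ((isClosed_tsupport _).preimage (continuous_map _ _)) he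
    exact ((ρ x).continuous.comp (continuous_map E.proj rfl)).continuousAt.mul
      (E.continuousAt_localLog p α (s x) (hs x) (hρ x he'))
  · intro L _ φ h t
    have hbase : (ofPoint (E.act t φ) (E.norm_preimage_act p t h)).map E.proj rfl =
        (ofPoint φ h).map (q := p) E.proj rfl := by
      rw [map_ofPoint, map_ofPoint]
      exact ofPoint_congr (E.act_proj t φ) _ _
    simp only [hbase]
    rw [← one_mul (∑ i, α i * Real.log (normCoord t i)), ← hsum ((ofPoint φ h).map E.proj rfl),
      Finset.sum_mul, ← Finset.sum_add_distrib]
    refine Finset.sum_congr rfl fun x _ => ?_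
    by_cases hx : ρ x ((ofPoint φ h).map E.proj rfl) = 0
    · rw [hx]; ring
    · have hmem : ((ofPoint φ h).map (q := p) E.proj rfl).pt ∈ U x := hρ x (subset_tsupport _ hx)
      rw [map_ofPoint, ofPoint_pt_mem] at hmem
      rw [E.localLog_act p α (s x) (hs x) φ h hmem t]
      ring

end Homogeneous

/-! ### Eigenfunctions of expanding dynamical systems -/

section Eigenfunction

/-- A continuous function that is an eigenfunction up to a bounded error `D` is corrected to an
eigenfunction by the series `∑ lam⁻ᵐ D ∘ Φᵐ`. -/
theorem continuous_and_eigenfunction_of_bounded {Z : Type*} [TopologicalSpace Z] {Φ : Z → Z}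
    (hΦ : Continuous Φ) {lam : ℝ} (hlam : 1 < lam) {G D : Z → ℝ} (hG : Continuous G)
    (hD : ∀ e, D e = lam⁻¹ * G (Φ e) - G e) {C : ℝ} (hC : ∀ e, |D e| ≤ C) :
    (Continuous fun e => G e + ∑' m : ℕ, lam⁻¹ ^ m * D (Φ^[m] e)) ∧
      ∀ e, G (Φ e) + ∑' m : ℕ, lam⁻¹ ^ m * D (Φ^[m] (Φ e)) =
        lam * (G e + ∑' m : ℕ, lam⁻¹ ^ m * D (Φ^[m] e)) := by
  have hpos : 0 < lam := one_pos.trans hlam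
  have hgeo : Summable fun m : ℕ => lam⁻¹ ^ m * C :=
    (summable_geometric_of_lt_one (inv_nonneg.2 hpos.le) (inv_lt_one_of_one_lt₀ hlam)).mul_right C
  have hbound (m : ℕ) (e : Z) : ‖lam⁻¹ ^ m * D (Φ^[m] e)‖ ≤ lam⁻¹ ^ m * C := by
    rw [norm_mul, norm_pow, norm_inv, Real.norm_of_nonneg hpos.le]
    exact mul_le_mul_of_nonneg_left (hC _) (pow_nonneg (inv_nonneg.2 hpos.le) _)
  have hDc : Continuous D := by
    rw [funext hD]
    exact ((hG.comp hΦ).const_mul _).sub hG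
  refine ⟨hG.add (continuous_tsum (fun m => (hDc.comp (hΦ.iterate m)).const_mul _) hgeo
    fun m e => hbound m e), fun e => ?_⟩
  have hs : Summable fun m : ℕ => lam⁻¹ ^ m * D (Φ^[m] e) :=
    Summable.of_norm_bounded hgeo fun m => hbound m e
  rw [hs.tsum_eq_zero_add, mul_add, mul_add, ← tsum_mul_left]
  have h1 (m : ℕ) : lam * (lam⁻¹ ^ (m + 1) * D (Φ^[m + 1] e)) = lam⁻¹ ^ m * D (Φ^[m] (Φ e)) := by
    rw [Function.iterate_succ_apply, pow_succ]
    field_simp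
  simp only [h1]
  rw [pow_zero, one_mul, Function.iterate_zero_apply, hD e]
  field_simp
  ring

theorem eq_zero_of_bounded_eigenfunction {Z : Type*} {Φ : Z → Z} {lam : ℝ} (hlam : 1 < lam)
    {D : Z → ℝ} (hD : ∀ e, D (Φ e) = lam * D e) {C : ℝ} (hC : ∀ e, |D e| ≤ C) (e : Z) :
    D e = 0 := by
  have hiter (m : ℕ) : D (Φ^[m] e) = lam ^ m * D e := by
    induction m with
    | zero => simp
    | succ m ih => rw [Function.iterate_succ_apply', hD, ih, pow_succ]; ring
  -- Otherwise `D` grows exponentially along the orbit of `e`.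
  by_contra hne
  obtain ⟨m, hm⟩ := pow_unbounded_of_one_lt (C / |D e|) hlam
  rw [div_lt_iff₀ (abs_pos.2 hne)] at hm
  have := hC (Φ^[m] e)
  rw [hiter, abs_mul, abs_of_pos (pow_pos (one_pos.trans hlam) m)] at this
  exact absurd hm this.not_gt

end Eigenfunction

end BerkK3

end

theorem mainTheorem4 {K : Type u} [NontriviallyNormedField K] [IsUltrametricDist K]
    [CompleteSpace K] [CharZero K]
    [CharZero (IsLocalRing.ResidueField (NormedField.valuation (K := K)).valuationSubring)]
    {X : Scheme.{u}} (p : X ⟶ Spec (CommRingCat.of K)) (hX : BerkK3.IsProjectiveK3Surface p)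
    (f : X ≅ X) (hf : f.hom ≫ p = p)
    {n : ℕ} (E : BerkK3.TorusTorsor n X)
    (F : E.total ⟶ E.total) (hF : F ≫ E.proj = E.proj ≫ f.hom)
    (A : Matrix (Fin n) (Fin n) ℤ) (hA : E.IsEquivariant F A)
    (v : Fin n → ℝ) (lam : ℝ) (hlam : 1 < lam)
    (hv : Module.End.HasEigenvector (Matrix.toLin' (A.transpose.map (Int.cast : ℤ → ℝ))) lam v) :
    ∃! G : BerkK3.Analytification (E.proj ≫ p) → ℝ,
      Continuous G ∧ E.IsHomogeneous p v G ∧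
      ∀ e : BerkK3.Analytification (E.proj ≫ p),
        G (e.map F (by rw [← Category.assoc, hF, Category.assoc, hf])) = lam * G e := by
  have hFp : F ≫ E.proj ≫ p = E.proj ≫ p := by rw [← Category.assoc, hF, Category.assoc, hf]
  have : IsProper p := hX.projective.isProper
  have : CompactSpace (BerkK3.Analytification p) := BerkK3.Analytification.compactSpace
  have : T2Space (BerkK3.Analytification p) := BerkK3.Analytification.t2Space
  have hlam0 : lam ≠ 0 := (one_pos.trans hlam).ne'
  refine existsUnique_of_exists_of_unique ?_ ?_
  · have hΦ := BerkK3.Analytification.continuous_map F hFp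
    have hAv : (A.transpose.map (Int.cast : ℤ → ℝ)).mulVec v = lam • v := by
      rw [← Matrix.toLin'_apply]; exact hv.apply_eq_smul
    obtain ⟨G₀, hG₀, hG₀v⟩ := E.exists_continuous_isStronglyHomogeneous p v
    -- The error of `G₀` as an eigenfunction is invariant under the torus, hence bounded.
    let D (e : BerkK3.Analytification (E.proj ≫ p)) : ℝ := lam⁻¹ * G₀ (e.map F hFp) - G₀ e
    have hDinv : E.IsStronglyHomogeneous p 0 D := by
      have h := ((hG₀v.comp_map hFp hA).smul lam⁻¹).sub hG₀v
      rwa [hAv, smul_smul, inv_mul_cancel₀ hlam0, one_smul, sub_self] at h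
    have hDc : Continuous D := ((hG₀.comp hΦ).const_mul _).sub hG₀
    obtain ⟨C, hC⟩ := E.exists_bound p hDc hDinv.translate_eq
    obtain ⟨hGc, hGF⟩ := BerkK3.continuous_and_eigenfunction_of_bounded (D := D) hΦ hlam hG₀
      (fun _ => rfl) hC
    have hDiter (m : ℕ) : E.IsStronglyHomogeneous p 0
        fun e => D ((fun e => e.map F hFp)^[m] e) := by
      induction m with
      | zero => exact hDinv
      | succ m ih =>
        have h := ih.comp_map hFp hA
        rw [Matrix.mulVec_zero] at h
        exact h
    refine ⟨_, hGc, ?_, hGF⟩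
    refine BerkK3.TorusTorsor.IsStronglyHomogeneous.isHomogeneous fun L _ φ h t => ?_
    have h1 (m : ℕ) := hDiter m L φ h t
    simp only [Pi.zero_apply, zero_mul, Finset.sum_const_zero, add_zero] at h1
    simp only [h1, hG₀v L φ h t]
    ring
  · rintro G G' ⟨hc, hh, he⟩ ⟨hc', hh', he'⟩
    obtain ⟨C, hC⟩ := E.exists_bound p (hc.sub hc') fun e t => by
      rw [Pi.sub_apply, Pi.sub_apply, hh e t, hh' e t]; ring
    refine funext fun e => sub_eq_zero.1 ?_
    exact BerkK3.eq_zero_of_bounded_eigenfunction (Φ := fun e => e.map F hFp) hlam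
      (D := fun e => G e - G' e) (fun e => by rw [he, he', mul_sub]) hC e
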